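/- Identify the orientation-preserving isometries of hyperbolic $3$-space with $\mathrm{PSL}(2,\mathbb{C})$. A subgroup of $\mathrm{PSL}(2,\mathbb{C})$ is called Kleinian if it is discrete and non-elementary, i.e. discrete and not virtually abelian. For $f,g\in\mathrm{PSL}(2,\mathbb{C})$ put $$\gamma(f,g)=\operatorname{tr}(fgf^{-1}g^{-1})-2,\qquad \beta(f)=\operatorname{tr}^2(f)-4,\qquad \beta(g)=\operatorname{tr}^2(g)-4;$$ the triple $(\gamma(f,g),\beta(f),\beta(g))\in\mathbb{C}^3$ is the principal character of the pair $(f,g)$. Theorem. If $f,g\in\mathrm{PSL}(2,\mathbb{C})$ generate a Kleinian group $\langle f,g\rangle$ and the principal character of $(f,g)$ is $(\gamma,\beta,-4)$, then $$|\gamma|+|\beta+2|\ \ge\ \frac{\sqrt5-1}{2}.$$ The inequality is sharp: there are $f,g$ with principal character $\left(\frac{\sqrt5-1}{2},-2,-4\right)$, for which equality holds, such that $\langle f,g\rangle$ is Kleinian and is the $(2,4,5)$ hyperbolic triangle group, i.e. it is conjugate in $\mathrm{PSL}(2,\mathbb{C})$ to the subgroup of $\mathrm{PSL}(2,\mathbb{R})$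 generated by the rotations through $2\pi/2$, $2\pi/4$, $2\pi/5$ about the vertices of a hyperbolic triangle in the upper half-plane with angles $\pi/2$, $\pi/4$, $\pi/5$ at those vertices. -/

import Mathlib

open scoped MatrixGroups UpperHalfPlane

noncomputable section

namespace PrincipalCharacter

/-- Two matrices of `SL(2, ℂ)` with the same image in `PSL(2, ℂ)` agree up to sign. -/
theorem eq_or_eq_neg {A B : SL(2, ℂ)} (h : (A : PSL(2, ℂ)) = (B : PSL(2, ℂ))) :
    B = A ∨ B = -A := by
  rw [QuotientGroup.eq, Matrix.SpecialLinearGroup.mem_center_iff] at h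
  obtain ⟨r, hr, h⟩ := h
  have hB : (B : Matrix (Fin 2) (Fin 2) ℂ) = r • (A : Matrix (Fin 2) (Fin 2) ℂ) := by
    have h1 : B = A * (A⁻¹ * B) := by group
    rw [h1, Matrix.SpecialLinearGroup.coe_mul, ← h]
    ext i j
    simp [mul_comm]
  have hr' : r = 1 ∨ r = -1 := by
    simpa using hr
  rcases hr' with rfl | rfl
  · left; ext i j; simp [hB]
  · right; ext i j; simp [hB]

/-- The parameter `β(f) = tr²(f) - 4` of an element of `PSL(2, ℂ)`; the squared trace does not
depend on the matrix representing the element. -/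
def beta (f : PSL(2, ℂ)) : ℂ :=
  Quotient.liftOn' f (fun A : SL(2, ℂ) => (A : Matrix (Fin 2) (Fin 2) ℂ).trace ^ 2 - 4) (by
    intro A B h
    rcases eq_or_eq_neg (Quotient.sound' h : (A : PSL(2, ℂ)) = (B : PSL(2, ℂ))) with rfl | rfl
    · rfl
    · simp)

/-- The parameter `γ(f, g) = tr [f, g] - 2`, where `[f, g] = f g f⁻¹ g⁻¹`; the trace of the
commutator does not depend on the matrices representing the two elements. -/
def gamma (f g : PSL(2, ℂ)) : ℂ :=
  Quotient.liftOn₂' f g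
    (fun A B : SL(2, ℂ) =>
      ((A * B * A⁻¹ * B⁻¹ : SL(2, ℂ)) : Matrix (Fin 2) (Fin 2) ℂ).trace - 2) (by
    intro A B A' B' hA hB
    have key : A * B * A⁻¹ * B⁻¹ = A' * B' * A'⁻¹ * B'⁻¹ := by
      have inv_neg' : ∀ C : SL(2, ℂ), (-C)⁻¹ = -C⁻¹ := fun C => by
        rw [inv_eq_iff_mul_eq_one]; simp
      rcases eq_or_eq_neg (Quotient.sound' hA : (A : PSL(2, ℂ)) = (A' : PSL(2, ℂ))) with
        rfl | rfl <;>
      rcases eq_or_eq_neg (Quotient.sound' hB : (B : PSL(2, ℂ)) = (B' : PSL(2, ℂ))) with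
        rfl | rfl <;>
      simp [inv_neg']
    simp only [key])

theorem beta_coe (A : SL(2, ℂ)) :
    beta (A : PSL(2, ℂ)) = (A : Matrix (Fin 2) (Fin 2) ℂ).trace ^ 2 - 4 := rfl

theorem gamma_coe (A B : SL(2, ℂ)) :
    gamma (A : PSL(2, ℂ)) (B : PSL(2, ℂ)) =
      ((A * B * A⁻¹ * B⁻¹ : SL(2, ℂ)) : Matrix (Fin 2) (Fin 2) ℂ).trace - 2 := rfl

/-- The principal character `(γ(f, g), β(f), β(g))` of the representation of the free group on
`a, b` given by `a ↦ f`, `b ↦ g`. -/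
def principalCharacter (f g : PSL(2, ℂ)) : ℂ × ℂ × ℂ := (gamma f g, beta f, beta g)

/-- A group is virtually abelian (a finite extension of an abelian group) if it has an abelian
subgroup of finite index. -/
def IsVirtuallyAbelian (H : Type*) [Group H] : Prop :=
  ∃ K : Subgroup H, K.FiniteIndex ∧ ∀ x ∈ K, ∀ y ∈ K, x * y = y * x

/-- A Kleinian group is a discrete subgroup of `PSL(2, ℂ)` (with its quotient topology) that is
non-elementary, i.e. not virtually abelian. -/
def IsKleinian (G : Subgroup PSL(2, ℂ)) : Prop :=
  DiscreteTopology G ∧ ¬ IsVirtuallyAbelian G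

/-- The holomorphic chart `w ↦ (w - z) / (w - conj z)` from the upper half-plane onto the unit
disc. It carries `z` to `0` and the hyperbolic geodesics through `z` to diameters. -/
def discChart (z w : ℍ) : ℂ :=
  ((w : ℂ) - (z : ℂ)) / ((w : ℂ) - (starRingEnd ℂ) (z : ℂ))

/-- The hyperbolic angle at `z` between the geodesic rays from `z` through `w₁` and through `w₂`
(for `w₁, w₂ ≠ z`), read off in the conformal disc centred at `z`. -/
def hyperbolicAngle (z w₁ w₂ : ℍ) : ℝ :=
  InnerProductGeometry.angle (discChart z w₁) (discChart z w₂)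

/-- `M` acts on the upper half-plane as the rotation about `z` through the angle `θ`: it fixes
`z`, and its derivative at `z` is `exp (iθ)`. -/
def IsRotation (M : SL(2, ℝ)) (z : ℍ) (θ : ℝ) : Prop :=
  M • z = z ∧
    HasDerivAt (fun w : ℂ => ((M 0 0 : ℂ) * w + (M 0 1 : ℂ)) / ((M 1 0 : ℂ) * w + (M 1 1 : ℂ)))
      (Complex.exp ((θ : ℂ) * Complex.I)) (z : ℂ)

/-- The natural homomorphism from `SL(2, ℝ)` to `PSL(2, ℂ)`. -/
def toPSL : SL(2, ℝ) →* PSL(2, ℂ) :=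
  (QuotientGroup.mk' (Subgroup.center SL(2, ℂ))).comp
    (Matrix.SpecialLinearGroup.map (algebraMap ℝ ℂ))

/-- `G` is a `(p, q, r)` hyperbolic triangle group: up to conjugation in `PSL(2, ℂ)`, it is
generated by the rotations through `2π/p`, `2π/q`, `2π/r` about the vertices `a`, `b`, `c` of a
hyperbolic triangle whose angles at these vertices are `π/p`, `π/q`, `π/r`. Equivalently, it is
the orientation-preserving part of the group generated by the reflections in the sides. -/
def IsHyperbolicTriangleGroup (p q r : ℕ) (G : Subgroup PSL(2, ℂ)) : Prop :=
  2 ≤ p ∧ 2 ≤ q ∧ 2 ≤ r ∧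
  ∃ a b c : ℍ, a ≠ b ∧ b ≠ c ∧ c ≠ a ∧
    hyperbolicAngle a b c = Real.pi / p ∧
    hyperbolicAngle b c a = Real.pi / q ∧
    hyperbolicAngle c a b = Real.pi / r ∧
    ∃ h : PSL(2, ℂ), G = Subgroup.map (MulAut.conj h).toMonoidHom
      (Subgroup.map toPSL (Subgroup.closure
        {M : SL(2, ℝ) | IsRotation M a (2 * Real.pi / p) ∨ IsRotation M b (2 * Real.pi / q) ∨
          IsRotation M c (2 * Real.pi / r)}))

end PrincipalCharacter

end

/-!
# A sharp inequality for Kleinian groups with a generator of order two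

Write `b = β + 2 = tr² A - 2` and `γ = tr [A, B] - 2` for lifts `A`, `B` of the two generators to
`SL(2, ℂ)`. The inequality is proved by a contraction of Jørgensen type. The word
`step A H = H A H⁻¹ A H A H⁻¹`, suggested by `(A H)⁴` for `H` of order two, satisfies
`γ(A, step A H) = γ (γ - β) (γ - β - 2)²` (`gam_step`). If `s = |γ| + |b|`, the factor of `γ` is at
most `(2 + s) s²`, which is below `1` exactly when `s < (√5 - 1) / 2`. Starting from `H = B` the
parameters then tend to `0`, and the iterates converge to `A³` after conjugation by suitable powers
of `A`. In a discrete group they are eventually equal to `A³`, so that some parameter of the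
sequence vanishes (`exists_gam_eq_zero`).

If a parameter vanishes for the first time after the start, then the previous one is equal to `b`.
In this case the partner `H` is replaced by an element `φ` of order two that conjugates `A` as `H`
does. The group generated by `A` and `φ` is still discrete, because it contains
`⟨A, H A H⁻¹, -1⟩` with index at most two. The product `A φ` has order exactly four, and for the
pair `(A φ, φ)` the recursion becomes `γ ↦ γ³ (γ + 2)`, which never reaches `0` from a small nonzero
value. This contradiction shows `γ = 0` (`gam_eq_zero_of_discrete`). A discrete reducible pair of
this kind generates a virtually abelian group (`isVirtuallyAbelian_of_triangular`): either all its
elements are diagonal, or `A` has finite order and the translations have finite index.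

For sharpness, `A` and `B` are explicit rotations through `π / 2` and `π`. Every word in them is
a combination of `1, A, B, A B` over `ℤ[φ]`, up to factors `√2` (`isEvenWord_or_isOddWord`). The
determinant is a quadratic form in the coefficients whose conjugate under `√5 ↦ -√5` is positive
definite. Hence the conjugates of the coefficients are bounded, and an element near the identity
has coefficients of norm less than `1`, which forces it to be the identity
(`eq_one_of_mem_closure`). This is the usual proof that an arithmetic group is discrete. The group
is not virtually abelian, since it contains two hyperbolic elements no powers of which commute.
Finally the triangle with vertices `i`, `vertexB`, `vertexC` has angles `π/2`, `π/4`, `π/5`, and the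
rotations about its vertices are `B`, `A` and `(A B)⁻¹` up to sign.
-/

open scoped MatrixGroups UpperHalfPlane

noncomputable section

namespace PrincipalCharacter

open Filter Topology

/-! ### Discrete subgroups of topological groups -/

section Discrete

variable {G H : Type*} [Group G] [TopologicalSpace G] [IsTopologicalGroup G]
  [Group H] [TopologicalSpace H] [IsTopologicalGroup H]

theorem discreteTopology_iff_eventually (Γ : Subgroup G) :
    DiscreteTopology Γ ↔ ∀ᶠ x in 𝓝 (1 : G), x ∈ Γ → x = 1 := by
  rw [discreteTopology_iff_isOpen_singleton_one]
  constructor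
  · intro h
    have h1 : ({1} : Set Γ) ∈ 𝓝 (1 : Γ) := h.mem_nhds rfl
    rw [nhds_subtype_eq_comap, mem_comap] at h1
    obtain ⟨U, hU, hU1⟩ := h1
    filter_upwards [hU] with x hx hxΓ
    exact congrArg Subtype.val (hU1 (show (⟨x, hxΓ⟩ : Γ) ∈ Subtype.val ⁻¹' U from hx))
  · intro h
    rw [isOpen_iff_mem_nhds]
    rintro _ rfl
    rw [nhds_subtype_eq_comap]
    exact ⟨_, h, fun x hx => Subtype.ext (hx x.2)⟩

/-- If `Γ` is covered by a discrete subgroup `N` and one coset of `N`, then `Γ` is discrete: two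
elements of the coset that are both close to `1` differ by an element of `N` close to `1`. -/
theorem discreteTopology_of_mem_or_mul_mem [T1Space G] {N Γ : Subgroup G} (φ : G)
    (hN : DiscreteTopology N) (h : ∀ x ∈ Γ, x ∈ N ∨ φ * x ∈ N) : DiscreteTopology Γ := by
  rw [discreteTopology_iff_eventually] at hN ⊢
  have hc : Tendsto (fun p : G × G => p.1⁻¹ * p.2) (𝓝 1 ×ˢ 𝓝 1) (𝓝 1) := by
    rw [← nhds_prod_eq]
    have : Continuous (fun p : G × G => p.1⁻¹ * p.2) := by fun_prop
    simpa using this.tendsto (1, 1)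
  obtain ⟨V, hV, hVN⟩ :=
    Filter.eventually_prod_self_iff (r := fun a b => a⁻¹ * b ∈ N → a⁻¹ * b = 1) |>.1
    (hc.eventually hN)
  by_cases hx : ∃ x₀ ∈ V, φ * x₀ ∈ N ∧ x₀ ≠ 1
  · obtain ⟨x₀, hx₀, hφ, hne⟩ := hx
    filter_upwards [hN, hV, isOpen_ne.mem_nhds hne.symm] with y hy hyV hyx hyΓ
    refine (h y hyΓ).elim hy fun hyφ => ?_
    have h1 := hVN x₀ hx₀ y hyV (by
      have := N.mul_mem (N.inv_mem hφ) hyφ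
      simpa [mul_assoc] using this)
    exact absurd (inv_mul_eq_one.1 h1).symm hyx
  · push Not at hx
    filter_upwards [hN, hV] with y hy hyV hyΓ
    exact (h y hyΓ).elim hy fun hyφ => hx y hyV hyφ

theorem discreteTopology_comap [T1Space G] {Γ : Subgroup H} (hΓ : DiscreteTopology Γ)
    (ψ : G →* H) (hψ : Continuous ψ) (hker : (ψ.ker : Set G).Finite) :
    DiscreteTopology (Γ.comap ψ) := by
  rw [discreteTopology_iff_eventually] at hΓ ⊢
  have h1 : Tendsto ψ (𝓝 1) (𝓝 1) := by simpa using hψ.tendsto 1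
  have h2 : ((ψ.ker : Set G) \ {1})ᶜ ∈ 𝓝 (1 : G) :=
    (hker.subset Set.sdiff_subset).isClosed.isOpen_compl.mem_nhds (by simp)
  filter_upwards [h1.eventually hΓ, h2] with x hx hx2 hxΓ
  by_contra hne
  exact hx2 ⟨hx hxΓ, hne⟩

/-- Discreteness descends to the quotient by a normal subgroup that the group contains. -/
theorem discreteTopology_map_mk {Γ N : Subgroup G} [N.Normal] (hΓ : DiscreteTopology Γ)
    (hN : N ≤ Γ) : DiscreteTopology (Γ.map (QuotientGroup.mk' N)) := by
  rw [discreteTopology_iff_eventually] at hΓ ⊢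
  have := (QuotientGroup.isOpenMap_coe (N := N)).image_mem_nhds hΓ
  filter_upwards [this] with x hx hxΓ
  obtain ⟨u, hu, rfl⟩ := hx
  obtain ⟨v, hv, hvu⟩ := hxΓ
  have huv : v⁻¹ * u ∈ N := QuotientGroup.eq.1 hvu
  have : u ∈ Γ := by simpa using Γ.mul_mem hv (hN huv)
  rw [hu this]; rfl

/-- A sequence in a discrete subgroup with a limit in the subgroup is eventually constant. -/
theorem eventually_eq_of_tendsto {Γ : Subgroup G} (hΓ : DiscreteTopology Γ) {x : ℕ → G} {y : G}
    (hx : ∀ n, x n ∈ Γ) (hy : y ∈ Γ) (h : Tendsto x atTop (𝓝 y)) : ∀ᶠ n in atTop, x n = y := by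
  rw [discreteTopology_iff_eventually] at hΓ
  have h1 : Tendsto (fun n => y⁻¹ * x n) atTop (𝓝 1) := by
    simpa using h.const_mul y⁻¹
  filter_upwards [h1.eventually hΓ] with n hn
  exact (inv_mul_eq_one.1 (hn (Γ.mul_mem (Γ.inv_mem hy) (hx n)))).symm

end Discrete

/-! ### The trace parameters on `SL(2, ℂ)` -/

section Entries

variable {R : Type*} [CommRing R]

theorem det_eq_one (H : SL(2, R)) : H 0 0 * H 1 1 - H 0 1 * H 1 0 = 1 := by
  rw [← Matrix.det_fin_two, H.det_coe]

theorem mul_entry (A B : SL(2, R)) (i j : Fin 2) :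
    (A * B) i j = A i 0 * B 0 j + A i 1 * B 1 j := by
  rw [Matrix.SpecialLinearGroup.coe_mul, Matrix.mul_apply, Fin.sum_univ_two]

theorem inv_00 (A : SL(2, R)) : A⁻¹ 0 0 = A 1 1 := by
  rw [Matrix.SpecialLinearGroup.SL2_inv_expl]; rfl

theorem inv_01 (A : SL(2, R)) : A⁻¹ 0 1 = -A 0 1 := by
  rw [Matrix.SpecialLinearGroup.SL2_inv_expl]; rfl

theorem inv_10 (A : SL(2, R)) : A⁻¹ 1 0 = -A 1 0 := by
  rw [Matrix.SpecialLinearGroup.SL2_inv_expl]; rfl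

theorem inv_11 (A : SL(2, R)) : A⁻¹ 1 1 = A 0 0 := by
  rw [Matrix.SpecialLinearGroup.SL2_inv_expl]; rfl

theorem ext_entries {A B : SL(2, R)} (h00 : A 0 0 = B 0 0) (h01 : A 0 1 = B 0 1)
    (h10 : A 1 0 = B 1 0) (h11 : A 1 1 = B 1 1) : A = B := by
  ext i j
  fin_cases i <;> fin_cases j <;> assumption

/-- The element of `SL(2, R)` with the given entries. -/
def mk2 (a b c d : R) (h : a * d - b * c = 1) : SL(2, R) :=
  ⟨!![a, b; c, d], by rw [Matrix.det_fin_two_of, h]⟩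

section

variable {a b c d : R} (h : a * d - b * c = 1)

theorem mk2_00 : mk2 a b c d h 0 0 = a := rfl
theorem mk2_01 : mk2 a b c d h 0 1 = b := rfl
theorem mk2_10 : mk2 a b c d h 1 0 = c := rfl
theorem mk2_11 : mk2 a b c d h 1 1 = d := rfl

end

end Entries

theorem tendsto_of_entries {ι : Type*} {l : Filter ι} {x : ι → SL(2, ℂ)} {y : SL(2, ℂ)}
    (h00 : Tendsto (fun n => x n 0 0) l (𝓝 (y 0 0)))
    (h01 : Tendsto (fun n => x n 0 1) l (𝓝 (y 0 1)))
    (h10 : Tendsto (fun n => x n 1 0) l (𝓝 (y 1 0)))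
    (h11 : Tendsto (fun n => x n 1 1) l (𝓝 (y 1 1))) : Tendsto x l (𝓝 y) := by
  refine tendsto_subtype_rng.2 (tendsto_pi_nhds.2 fun i => tendsto_pi_nhds.2 fun j => ?_)
  fin_cases i <;> fin_cases j <;> assumption

/-- The commutator parameter `tr [A, H] - 2` of a pair of matrices. -/
def gam (A H : SL(2, ℂ)) : ℂ :=
  ((A * H * A⁻¹ * H⁻¹ : SL(2, ℂ)) : Matrix (Fin 2) (Fin 2) ℂ).trace - 2

/-- The trace of a matrix in `SL(2, ℂ)`. -/
def tr (A : SL(2, ℂ)) : ℂ := (A : Matrix (Fin 2) (Fin 2) ℂ).trace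

/-- The diagonal matrix `diag(l, l⁻¹)`. -/
def dg (l : ℂˣ) : SL(2, ℂ) := ⟨!![(l : ℂ), 0; 0, ((l⁻¹ : ℂˣ) : ℂ)], by simp⟩

/-- The word `H A H⁻¹ A H A H⁻¹`. If `H` has order two in `PSL(2, ℂ)`, then `A * step A H` and
`(A H)⁴` agree there. The word depends on `H` only through `H A H⁻¹`, so the effect on
`gam A H` is the same for every `H`. -/
def step (A H : SL(2, ℂ)) : SL(2, ℂ) := H * A * H⁻¹ * A * H * A * H⁻¹

theorem tr_eq (A : SL(2, ℂ)) : tr A = A 0 0 + A 1 1 := Matrix.trace_fin_two _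

theorem tr_conj (P A : SL(2, ℂ)) : tr (P * A * P⁻¹) = tr A := by
  unfold tr
  rw [Matrix.SpecialLinearGroup.coe_mul, Matrix.trace_mul_comm,
    ← Matrix.SpecialLinearGroup.coe_mul]
  simp

theorem gam_eq (A H : SL(2, ℂ)) : gam A H = tr (A * H * A⁻¹ * H⁻¹) - 2 := rfl

theorem gam_conj (P A H : SL(2, ℂ)) : gam (P * A * P⁻¹) (P * H * P⁻¹) = gam A H := by
  rw [gam_eq, gam_eq, ← tr_conj P (A * H * A⁻¹ * H⁻¹)]
  congr 2
  group

theorem step_conj (P A H : SL(2, ℂ)) :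
    step (P * A * P⁻¹) (P * H * P⁻¹) = P * step A H * P⁻¹ := by
  unfold step; group

theorem step_mem {Γ : Subgroup SL(2, ℂ)} {A H : SL(2, ℂ)} (hA : A ∈ Γ) (hH : H ∈ Γ) :
    step A H ∈ Γ := by
  unfold step
  have := Γ.inv_mem hH
  repeat first | assumption | apply Γ.mul_mem

/-- The Fricke identity for a pair whose second member has order two. -/
theorem tr_mul_sq (A H : SL(2, ℂ)) (hH : tr H = 0) :
    tr (A * H) ^ 2 = gam A H + 4 - tr A ^ 2 := by
  have h1 := det_eq_one A
  have h2 := det_eq_one H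
  rw [gam_eq]
  simp only [tr_eq, mul_entry, inv_00, inv_01, inv_10, inv_11] at *
  obtain hp := eq_neg_of_add_eq_zero_right hH
  rw [hp] at h2 ⊢
  generalize A 0 0 = a at *
  generalize A 0 1 = b at *
  generalize A 1 0 = c at *
  generalize A 1 1 = d at *
  generalize H 0 1 = q at *
  generalize H 1 0 = r at *
  generalize H 0 0 = p at *
  clear hp hH
  grind

section Diagonal

variable (l : ℂˣ) (H : SL(2, ℂ))

theorem dg_00 : dg l 0 0 = l := rfl
theorem dg_01 : dg l 0 1 = 0 := rfl
theorem dg_10 : dg l 1 0 = 0 := rfl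
theorem dg_11 : dg l 1 1 = (l : ℂ)⁻¹ := by simp [dg]

theorem tr_dg : tr (dg l) = l + (l : ℂ)⁻¹ := by rw [tr_eq, dg_00, dg_11]

theorem gam_dg : gam (dg l) H = -((l : ℂ) - (l : ℂ)⁻¹) ^ 2 * (H 0 1 * H 1 0) := by
  have h := det_eq_one H
  have hl : (l : ℂ) * (l : ℂ)⁻¹ = 1 := by simp
  rw [gam_eq]
  simp only [tr_eq, mul_entry, inv_00, inv_01, inv_10, inv_11, dg_00, dg_01, dg_10, dg_11]
  linear_combination 2 * (l : ℂ) * (l : ℂ)⁻¹ * h + 2 * hl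

/-- The trace of `H D H⁻¹ D`, where `D = diag(l, l⁻¹)`, as a function of `w = H₀₁ H₁₀`. -/
def crossTrace (w : ℂ) : ℂ := (l : ℂ) ^ 2 + (l : ℂ)⁻¹ ^ 2 + ((l : ℂ) - (l : ℂ)⁻¹) ^ 2 * w

theorem mul_dg_mul_entry (A B : SL(2, ℂ)) (i j : Fin 2) :
    (A * dg l * B) i j = A i 0 * l * B 0 j + A i 1 * (l : ℂ)⁻¹ * B 1 j := by
  rw [mul_entry, mul_entry, mul_entry, dg_00, dg_01, dg_10, dg_11]
  ring

theorem conj_dg_00 : (H * dg l * H⁻¹) 0 0 =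
    l + H 0 1 * H 1 0 * ((l : ℂ) - (l : ℂ)⁻¹) := by
  simp only [mul_entry, inv_00, inv_10, dg_00, dg_01, dg_10, dg_11]
  linear_combination (l : ℂ) * det_eq_one H

theorem conj_dg_01 : (H * dg l * H⁻¹) 0 1 = -(H 0 0 * H 0 1 * ((l : ℂ) - (l : ℂ)⁻¹)) := by
  simp only [mul_entry, inv_01, inv_11, dg_00, dg_01, dg_10, dg_11]
  ring

theorem conj_dg_10 : (H * dg l * H⁻¹) 1 0 = H 1 0 * H 1 1 * ((l : ℂ) - (l : ℂ)⁻¹) := by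
  simp only [mul_entry, inv_00, inv_10, dg_00, dg_01, dg_10, dg_11]
  ring

theorem conj_dg_11 : (H * dg l * H⁻¹) 1 1 =
    (l : ℂ)⁻¹ - H 0 1 * H 1 0 * ((l : ℂ) - (l : ℂ)⁻¹) := by
  simp only [mul_entry, inv_01, inv_11, dg_00, dg_01, dg_10, dg_11]
  linear_combination (l : ℂ)⁻¹ * det_eq_one H

theorem step_dg : step (dg l) H = (H * dg l * H⁻¹) * dg l * (H * dg l * H⁻¹) := by
  unfold step; group

theorem l_mul_inv : (l : ℂ) * (l : ℂ)⁻¹ = 1 := by simp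

theorem conj_dg_01_mul_10 : (H * dg l * H⁻¹) 0 1 * (H * dg l * H⁻¹) 1 0 =
    -((H 0 1 * H 1 0) * (1 + H 0 1 * H 1 0) * ((l : ℂ) - (l : ℂ)⁻¹) ^ 2) := by
  rw [conj_dg_01, conj_dg_10]
  linear_combination -((H 0 1 * H 1 0) * ((l : ℂ) - (l : ℂ)⁻¹) ^ 2) * det_eq_one H

theorem step_dg_00 : step (dg l) H 0 0 =
    (l + H 0 1 * H 1 0 * ((l : ℂ) - (l : ℂ)⁻¹)) ^ 2 * l -
      (H 0 1 * H 1 0) * (1 + H 0 1 * H 1 0) * ((l : ℂ) - (l : ℂ)⁻¹) ^ 2 * (l : ℂ)⁻¹ := by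
  have h := conj_dg_01_mul_10 l H
  rw [step_dg, mul_dg_mul_entry, ← conj_dg_00]
  linear_combination (l : ℂ)⁻¹ * h

theorem step_dg_11 : step (dg l) H 1 1 =
    ((l : ℂ)⁻¹ - H 0 1 * H 1 0 * ((l : ℂ) - (l : ℂ)⁻¹)) ^ 2 * (l : ℂ)⁻¹ -
      (H 0 1 * H 1 0) * (1 + H 0 1 * H 1 0) * ((l : ℂ) - (l : ℂ)⁻¹) ^ 2 * l := by
  have h := conj_dg_01_mul_10 l H
  rw [step_dg, mul_dg_mul_entry, ← conj_dg_11]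
  linear_combination (l : ℂ) * h

theorem step_dg_01 : step (dg l) H 0 1 =
    -(H 0 0 * ((l : ℂ) - (l : ℂ)⁻¹) * crossTrace l (H 0 1 * H 1 0)) * H 0 1 := by
  rw [step_dg, mul_dg_mul_entry,
    conj_dg_00, conj_dg_01, conj_dg_11, crossTrace]
  ring

theorem step_dg_10 : step (dg l) H 1 0 =
    (H 1 1 * ((l : ℂ) - (l : ℂ)⁻¹) * crossTrace l (H 0 1 * H 1 0)) * H 1 0 := by
  rw [step_dg, mul_dg_mul_entry,
    conj_dg_00, conj_dg_10, conj_dg_11, crossTrace]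
  ring

theorem tr_dg_sq : tr (dg l) ^ 2 = (l : ℂ) ^ 2 + (l : ℂ)⁻¹ ^ 2 + 2 := by
  rw [tr_dg]; linear_combination 2 * l_mul_inv l

theorem sub_inv_sq : ((l : ℂ) - (l : ℂ)⁻¹) ^ 2 = tr (dg l) ^ 2 - 4 := by
  rw [tr_dg]; linear_combination -4 * l_mul_inv l

theorem crossTrace_eq : crossTrace l (H 0 1 * H 1 0) = tr (dg l) ^ 2 - 2 - gam (dg l) H := by
  rw [gam_dg, tr_dg_sq, crossTrace]; ring

/-- The parameter of `step D H` is a polynomial in that of `H`: with `β = tr² D - 4` it is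
`γ (γ - β) (γ - β - 2)²`, a shifted Chebyshev polynomial. -/
theorem gam_step_dg : gam (dg l) (step (dg l) H) = gam (dg l) H *
    ((gam (dg l) H - (tr (dg l) ^ 2 - 4)) * (gam (dg l) H - (tr (dg l) ^ 2 - 2)) ^ 2) := by
  have hc := crossTrace_eq l H
  have h1 : gam (dg l) H - (tr (dg l) ^ 2 - 2) = -crossTrace l (H 0 1 * H 1 0) := by
    rw [hc]; ring
  rw [h1, gam_dg, step_dg_01, step_dg_10, ← sub_inv_sq, gam_dg]
  generalize crossTrace l (H 0 1 * H 1 0) = T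
  linear_combination ((l : ℂ) - (l : ℂ)⁻¹) ^ 4 * (H 0 1 * H 1 0) * T ^ 2 * det_eq_one H

end Diagonal

/-! ### The iteration of the commutator parameter -/

/-- The number `(√5 - 1) / 2` is the positive root of `s² + s = 1`, and it is also where
`(2 + s) s²` reaches `1`. -/
theorem contraction_lt_one {s : ℝ} (h0 : 0 ≤ s) (hs : s < (√5 - 1) / 2) :
    (2 + s) * s ^ 2 < 1 := by
  have h5 : √5 ^ 2 = 5 := Real.sq_sqrt (by norm_num)
  have h1 : s ^ 2 + s < 1 := by nlinarith [Real.sqrt_nonneg 5]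
  nlinarith

theorem norm_factor_le {g x : ℂ} {s : ℝ} (h : ‖g‖ + ‖x - 2‖ ≤ s) :
    ‖(g - (x - 4)) * (g - (x - 2)) ^ 2‖ ≤ (2 + s) * s ^ 2 := by
  have h1 : ‖g - (x - 2)‖ ≤ s := (norm_sub_le _ _).trans h
  have h2 : ‖g - (x - 4)‖ ≤ 2 + s := by
    have : g - (x - 4) = 2 + (g - (x - 2)) := by ring
    rw [this]
    refine (norm_add_le _ _).trans ?_
    simpa using h1
  rw [norm_mul, norm_pow]
  have := (norm_nonneg _).trans h1
  gcongr

/-- The recursion satisfied by the commutator parameters contracts to `0`. -/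
theorem tendsto_zero_of_recursion {g : ℕ → ℂ} {x : ℂ}
    (hg : ∀ n, g (n + 1) = g n * ((g n - (x - 4)) * (g n - (x - 2)) ^ 2))
    (hs : ‖g 0‖ + ‖x - 2‖ < (√5 - 1) / 2) :
    (∀ n, ‖g n‖ ≤ ‖g 0‖) ∧ Tendsto g atTop (𝓝 0) := by
  have hq := contraction_lt_one (by positivity) hs
  set q := (2 + (‖g 0‖ + ‖x - 2‖)) * (‖g 0‖ + ‖x - 2‖) ^ 2
  have key : ∀ n, ‖g n‖ ≤ ‖g 0‖ → ‖g (n + 1)‖ ≤ q * ‖g n‖ := fun n hn => by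
    rw [hg, norm_mul, mul_comm]
    gcongr
    exact norm_factor_le (by gcongr)
  have hle : ∀ n, ‖g n‖ ≤ ‖g 0‖ := fun n => by
    induction n with
    | zero => exact le_rfl
    | succ n ih => exact ((key n ih).trans (mul_le_of_le_one_left (norm_nonneg _) hq.le)).trans ih
  exact ⟨hle, (summable_of_ratio_norm_eventually_le hq
    (Eventually.of_forall fun n => key n (hle n))).tendsto_atTop_zero⟩

theorem tendsto_zero_of_ratio {u c : ℕ → ℂ} {L : ℂ} (h : ∀ n, u (n + 1) = c n * u n)
    (hc : Tendsto c atTop (𝓝 L)) (hL : ‖L‖ < 1) : Tendsto u atTop (𝓝 0) := by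
  obtain ⟨r, hr1, hr2⟩ := exists_between hL
  refine (summable_of_ratio_norm_eventually_le hr2 ?_).tendsto_atTop_zero
  filter_upwards [hc.norm.eventually (gt_mem_nhds hr1)] with n hn
  rw [h, norm_mul]
  gcongr

theorem dg_mul (l m : ℂˣ) : dg (l * m) = dg l * dg m := by
  apply ext_entries <;> simp only [mul_entry, dg_00, dg_01, dg_10, dg_11, Units.val_mul] <;>
    ring

theorem dg_one : dg 1 = 1 := by
  apply ext_entries <;> simp [dg]

/-- The diagonal one-parameter subgroup `l ↦ diag(l, l⁻¹)`. -/
def dgHom : ℂˣ →* SL(2, ℂ) where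
  toFun := dg
  map_one' := dg_one
  map_mul' := dg_mul

theorem dg_zpow (l : ℂˣ) (m : ℤ) : dg (l ^ m) = dg l ^ m := map_zpow dgHom l m

theorem dg_pow (l : ℂˣ) (m : ℕ) : dg (l ^ m) = dg l ^ m := map_pow dgHom l m

section

variable (u : ℂˣ) (H : SL(2, ℂ))

theorem dg_conj_00 : (dg u * H * (dg u)⁻¹) 0 0 = H 0 0 := by
  simp only [mul_entry, inv_00, inv_10, dg_00, dg_01, dg_10, dg_11]
  linear_combination H 0 0 * l_mul_inv u

theorem dg_conj_11 : (dg u * H * (dg u)⁻¹) 1 1 = H 1 1 := by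
  simp only [mul_entry, inv_01, inv_11, dg_00, dg_01, dg_10, dg_11]
  linear_combination H 1 1 * l_mul_inv u

theorem dg_conj_01 : (dg u * H * (dg u)⁻¹) 0 1 = (u : ℂ) ^ 2 * H 0 1 := by
  simp only [mul_entry, inv_01, inv_11, dg_00, dg_01]
  ring

theorem dg_conj_10 : (dg u * H * (dg u)⁻¹) 1 0 = (u : ℂ)⁻¹ ^ 2 * H 1 0 := by
  simp only [mul_entry, inv_00, inv_10, dg_10, dg_11]
  ring

end

/-- If `|l| > 1`, the off-diagonal entries `b`, `c` can be balanced by conjugating with a power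
of `diag(l, l⁻¹)`. -/
theorem exists_balancing {l : ℂˣ} (hl : 1 < ‖(l : ℂ)‖) {b c : ℂ} (hb : b ≠ 0) (hc : c ≠ 0) :
    ∃ m : ℤ, ‖((l ^ m : ℂˣ) : ℂ) ^ 2 * b‖ ^ 2 ≤ ‖(l : ℂ)‖ ^ 4 * ‖b * c‖ ∧
      ‖((l ^ m : ℂˣ) : ℂ)⁻¹ ^ 2 * c‖ ^ 2 ≤ ‖(l : ℂ)‖ ^ 4 * ‖b * c‖ := by
  have hb' := norm_pos_iff.2 hb
  have hc' := norm_pos_iff.2 hc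
  have hy : 1 < ‖(l : ℂ)‖ ^ 4 := one_lt_pow₀ hl (by norm_num)
  obtain ⟨m, hm1, hm2⟩ := exists_mem_Ico_zpow (div_pos hc' hb') hy
  have hp : 0 < (‖(l : ℂ)‖ ^ 4) ^ m := by positivity
  rw [zpow_add_one₀ (by positivity)] at hm2
  have hu : ‖((l ^ m : ℂˣ) : ℂ)‖ ^ 4 = (‖(l : ℂ)‖ ^ 4) ^ m := by
    rw [Units.val_zpow_eq_zpow_val, norm_zpow, ← zpow_natCast, ← zpow_natCast, ← zpow_mul,
      ← zpow_mul, mul_comm]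
  refine ⟨m, ?_, ?_⟩
  · have : ‖((l ^ m : ℂˣ) : ℂ) ^ 2 * b‖ ^ 2 = (‖(l : ℂ)‖ ^ 4) ^ m * ‖b‖ * ‖b‖ := by
      rw [norm_mul, norm_pow, ← hu]; ring
    rw [this, norm_mul]
    rw [le_div_iff₀ hb'] at hm1
    calc _ ≤ ‖c‖ * ‖b‖ := by gcongr
      _ = 1 * (‖b‖ * ‖c‖) := by ring
      _ ≤ _ := by gcongr
  · have : ‖((l ^ m : ℂˣ) : ℂ)⁻¹ ^ 2 * c‖ ^ 2 = ((‖(l : ℂ)‖ ^ 4) ^ m)⁻¹ * ‖c‖ * ‖c‖ := by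
      rw [norm_mul, norm_pow, norm_inv, ← hu]; ring
    rw [this, norm_mul]
    rw [div_lt_iff₀ hb'] at hm2
    calc _ ≤ ((‖(l : ℂ)‖ ^ 4) ^ m)⁻¹ * ((‖(l : ℂ)‖ ^ 4) ^ m * ‖(l : ℂ)‖ ^ 4 * ‖b‖) * ‖c‖ := by
          gcongr
      _ = _ := by field_simp

theorem tendsto_zero_of_norm_sq_le {u v : ℕ → ℂ} {K : ℝ} (h : ∀ n, ‖u n‖ ^ 2 ≤ K * ‖v n‖)
    (hv : Tendsto v atTop (𝓝 0)) : Tendsto u atTop (𝓝 0) := by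
  have h1 : Tendsto (fun n => ‖u n‖ ^ 2) atTop (𝓝 0) := by
    refine squeeze_zero (fun n => by positivity) h ?_
    simpa using hv.norm.const_mul K
  rw [tendsto_zero_iff_norm_tendsto_zero]
  simpa using h1.sqrt

/-- The iterates of `H ↦ step D H`, where `D = diag(l, l⁻¹)`, converge to `D³` up to conjugation
by powers of `D`; in a discrete group they eventually equal `D³`, and so commute with `D`. -/
theorem exists_gam_eq_zero_of_dg {l : ℂˣ} {H : SL(2, ℂ)} {Γ : Subgroup SL(2, ℂ)}
    (hΓ : DiscreteTopology Γ) (hD : dg l ∈ Γ) (hH : H ∈ Γ) (hl : 1 ≤ ‖(l : ℂ)‖)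
    (hs : ‖gam (dg l) H‖ + ‖tr (dg l) ^ 2 - 2‖ < (√5 - 1) / 2) :
    ∃ n, gam (dg l) ((step (dg l))^[n] H) = 0 := by
  by_contra! hne
  set h : ℕ → SL(2, ℂ) := fun n => (step (dg l))^[n] H with hdef
  have hsucc : ∀ n, h (n + 1) = step (dg l) (h n) := fun n =>
    Function.iterate_succ_apply' _ _ _
  have hmem : ∀ n, h n ∈ Γ := fun n => by
    induction n with
    | zero => exact hH
    | succ n ih => rw [hsucc]; exact step_mem hD ih
  have hlim : Tendsto (fun n => gam (dg l) (h n)) atTop (𝓝 0) :=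
    (tendsto_zero_of_recursion (fun n => by rw [hsucc, gam_step_dg]) hs).2
  set e : ℂ := (l : ℂ) - (l : ℂ)⁻¹ with he
  set w : ℕ → ℂ := fun n => h n 0 1 * h n 1 0 with hw
  have hgw : ∀ n, gam (dg l) (h n) = -e ^ 2 * w n := fun n => gam_dg l (h n)
  have he0 : e ≠ 0 := fun h0 => hne 0 (by rw [hgw 0, h0]; simp)
  have hw0 : ∀ n, w n ≠ 0 := fun n h0 => hne n (by rw [hgw, h0]; simp)
  have hwlim : Tendsto w atTop (𝓝 0) := by
    have : w = fun n => (-e ^ 2)⁻¹ * gam (dg l) (h n) := by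
      funext n; rw [hgw]; field_simp
    rw [this]; simpa using hlim.const_mul (-e ^ 2)⁻¹
  have ha : Tendsto (fun n => h (n + 1) 0 0) atTop (𝓝 ((l : ℂ) ^ 3)) := by
    have : Tendsto (fun n => ((l : ℂ) + w n * e) ^ 2 * l - w n * (1 + w n) * e ^ 2 * (l : ℂ)⁻¹)
        atTop (𝓝 (((l : ℂ) + 0 * e) ^ 2 * l - 0 * (1 + 0) * e ^ 2 * (l : ℂ)⁻¹)) :=
      ((((hwlim.mul_const e).const_add (l : ℂ)).pow 2).mul_const (l : ℂ)).sub
        (((hwlim.mul (hwlim.const_add 1)).mul_const (e ^ 2)).mul_const (l : ℂ)⁻¹)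
    convert this using 2
    · rw [hsucc, step_dg_00]
    · ring
  have hd : Tendsto (fun n => h (n + 1) 1 1) atTop (𝓝 ((l : ℂ)⁻¹ ^ 3)) := by
    have : Tendsto (fun n => ((l : ℂ)⁻¹ - w n * e) ^ 2 * (l : ℂ)⁻¹ - w n * (1 + w n) * e ^ 2 * l)
        atTop (𝓝 (((l : ℂ)⁻¹ - 0 * e) ^ 2 * (l : ℂ)⁻¹ - 0 * (1 + 0) * e ^ 2 * l)) :=
      ((((hwlim.mul_const e).const_sub (l : ℂ)⁻¹).pow 2).mul_const (l : ℂ)⁻¹).sub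
        (((hwlim.mul (hwlim.const_add 1)).mul_const (e ^ 2)).mul_const (l : ℂ))
    convert this using 2
    · rw [hsucc, step_dg_11]
    · ring
  -- Conjugation by suitable powers of `D` makes the off-diagonal entries tend to `0`.
  obtain ⟨m, hm1, hm2⟩ : ∃ m : ℕ → ℤ,
      Tendsto (fun n => ((l ^ m n : ℂˣ) : ℂ) ^ 2 * h (n + 1) 0 1) atTop (𝓝 0) ∧
      Tendsto (fun n => ((l ^ m n : ℂˣ) : ℂ)⁻¹ ^ 2 * h (n + 1) 1 0) atTop (𝓝 0) := by
    rcases hl.eq_or_lt with hl1 | hl1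
    · -- For `|l| = 1` the entries decrease geometrically, with limiting ratio below `1`.
      refine ⟨fun _ => 0, ?_⟩
      have hT : Tendsto (fun n => crossTrace l (w (n + 1))) atTop (𝓝 (tr (dg l) ^ 2 - 2)) := by
        have : Tendsto (fun n => crossTrace l (w (n + 1))) atTop
            (𝓝 ((l : ℂ) ^ 2 + (l : ℂ)⁻¹ ^ 2 + e ^ 2 * 0)) :=
          ((hwlim.comp (tendsto_add_atTop_nat 1)).const_mul (e ^ 2)).const_add _
        convert this using 2
        rw [tr_dg_sq]; ring
      have hsq : (‖e‖ * ‖tr (dg l) ^ 2 - 2‖) ^ 2 < 1 := by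
        have h1 := norm_factor_le (g := 0) (x := tr (dg l) ^ 2)
          (s := ‖gam (dg l) H‖ + ‖tr (dg l) ^ 2 - 2‖) (by simp)
        have h2 := contraction_lt_one (by positivity) hs
        rw [mul_pow, ← norm_pow e, sub_inv_sq]
        simp only [zero_sub, norm_mul, norm_pow, norm_neg] at h1
        exact h1.trans_lt h2
      have hlt : ‖e‖ * ‖tr (dg l) ^ 2 - 2‖ < 1 := by
        rw [sq_lt_one_iff₀ (by positivity)] at hsq; exact hsq
      constructor
      · simp only [zpow_zero, Units.val_one, one_pow, one_mul]
        refine tendsto_zero_of_ratio (c := fun n => -(h (n + 1) 0 0 * e * crossTrace l (w (n + 1))))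
          (fun n => by rw [hsucc (n + 1), step_dg_01]) ((ha.mul_const e).mul hT).neg ?_
        simpa [← hl1] using hlt
      · simp only [zpow_zero, Units.val_one, inv_one, one_pow, one_mul]
        refine tendsto_zero_of_ratio (c := fun n => h (n + 1) 1 1 * e * crossTrace l (w (n + 1)))
          (fun n => by rw [hsucc (n + 1), step_dg_10]) ((hd.mul_const e).mul hT) ?_
        simpa [← hl1] using hlt
    · choose m hm using fun n => exists_balancing hl1 (left_ne_zero_of_mul (hw0 (n + 1)))
        (right_ne_zero_of_mul (hw0 (n + 1)))
      have := hwlim.comp (tendsto_add_atTop_nat 1)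
      exact ⟨m, tendsto_zero_of_norm_sq_le (fun n => (hm n).1) this,
        tendsto_zero_of_norm_sq_le (fun n => (hm n).2) this⟩
  have hconv : Tendsto (fun n => dg (l ^ m n) * h (n + 1) * (dg (l ^ m n))⁻¹) atTop
      (𝓝 (dg (l ^ 3))) := by
    apply tendsto_of_entries
    · simpa only [dg_conj_00, dg_00, Units.val_pow_eq_pow_val] using ha
    · simpa only [dg_conj_01, dg_01] using hm1
    · simpa only [dg_conj_10, dg_10] using hm2
    · simpa only [dg_conj_11, dg_11, Units.val_pow_eq_pow_val, inv_pow] using hd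
  have hdg : ∀ k : ℤ, dg (l ^ k) ∈ Γ := fun k => by rw [dg_zpow]; exact Γ.zpow_mem hD k
  obtain ⟨n, hn⟩ := (eventually_eq_of_tendsto hΓ
    (fun n => Γ.mul_mem (Γ.mul_mem (hdg _) (hmem (n + 1))) (Γ.inv_mem (hdg _)))
    (by rw [dg_pow]; exact Γ.pow_mem hD 3) hconv).exists
  have h01 := dg_conj_01 (l ^ m n) (h (n + 1))
  rw [hn, dg_01] at h01
  exact left_ne_zero_of_mul (hw0 (n + 1))
    ((mul_eq_zero.1 h01.symm).resolve_left (pow_ne_zero _ (Units.ne_zero _)))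

/-! ### Diagonalization and conjugation invariance -/

theorem exists_eigenvalue (x : ℂ) : ∃ l : ℂˣ, 1 ≤ ‖(l : ℂ)‖ ∧ (l : ℂ) + (l : ℂ)⁻¹ = x := by
  obtain ⟨s, hs⟩ := IsAlgClosed.exists_pow_nat_eq (x ^ 2 - 4) (n := 2) (by norm_num)
  have h1 : (x + s) / 2 * ((x - s) / 2) = 1 := by linear_combination -hs / 4
  have h2 : (x + s) / 2 ≠ 0 := left_ne_zero_of_mul_eq_one h1
  have h3 : ((x + s) / 2)⁻¹ = (x - s) / 2 := inv_eq_of_mul_eq_one_right h1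
  rcases le_total 1 ‖(x + s) / 2‖ with h | h
  · refine ⟨Units.mk0 _ h2, h, ?_⟩
    rw [Units.val_mk0, h3]; ring
  · refine ⟨(Units.mk0 _ h2)⁻¹, ?_, ?_⟩
    · rw [Units.val_inv_eq_inv_val, norm_inv]
      exact (one_le_inv₀ (norm_pos_iff.2 h2)).2 h
    · rw [Units.val_inv_eq_inv_val, inv_inv, Units.val_mk0, h3]; ring

theorem exists_conj_eq_dg {A : SL(2, ℂ)} (hA : tr A ^ 2 ≠ 4) :
    ∃ (P : SL(2, ℂ)) (l : ℂˣ), 1 ≤ ‖(l : ℂ)‖ ∧ P * A * P⁻¹ = dg l := by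
  obtain ⟨l, hl, hx⟩ := exists_eigenvalue (tr A)
  have hll := l_mul_inv l
  have hne : (l : ℂ) - (l : ℂ)⁻¹ ≠ 0 := fun h => hA (by
    rw [← hx]; linear_combination (l - (l : ℂ)⁻¹) * h + 4 * hll)
  have hdet := det_eq_one A
  rw [tr_eq] at hx
  -- The columns `(p, r)` and `(q, s)` are eigenvectors for `l` and `l⁻¹`.
  suffices h : ∃ p q r s : ℂ, p * s - q * r = 1 ∧ A 0 0 * p + A 0 1 * r = p * l ∧
      A 0 0 * q + A 0 1 * s = q * (l : ℂ)⁻¹ ∧ A 1 0 * p + A 1 1 * r = r * l ∧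
      A 1 0 * q + A 1 1 * s = s * (l : ℂ)⁻¹ by
    obtain ⟨p, q, r, s, h, h1, h2, h3, h4⟩ := h
    have hQ : A * mk2 p q r s h = mk2 p q r s h * dg l := by
      apply ext_entries <;>
        simp only [mul_entry, mk2_00, mk2_01, mk2_10, mk2_11, dg_00, dg_01, dg_10, dg_11,
          mul_zero, zero_add, add_zero] <;> assumption
    exact ⟨(mk2 p q r s h)⁻¹, l, hl, by rw [mul_assoc, inv_inv, hQ, inv_mul_cancel_left]⟩
  have hd' : A 1 1 = l + (l : ℂ)⁻¹ - A 0 0 := by linear_combination -hx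
  rw [hd'] at hdet ⊢
  generalize A 0 0 = a at *
  generalize A 0 1 = b at *
  generalize A 1 0 = c at *
  clear hx hd'
  generalize (l : ℂ)⁻¹ = m at *
  generalize (l : ℂ) = l at *
  by_cases hb : b = 0
  · by_cases hc : c = 0
    · have h1 : (a - l) * (a - m) = 0 := by
        rw [hb] at hdet; linear_combination -hdet + hll
      rcases mul_eq_zero.1 h1 with h | h
      · refine ⟨1, 0, 0, 1, by ring, ?_, ?_, ?_, ?_⟩ <;> rw [sub_eq_zero.1 h] <;>
          simp only [hb, hc] <;> ring
      · refine ⟨0, -1, 1, 0, by ring, ?_, ?_, ?_, ?_⟩ <;> rw [sub_eq_zero.1 h] <;>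
          simp only [hb, hc] <;> ring
    · refine ⟨a - m, (a - l) / (c * (l - m)), c, 1 / (l - m), ?_, ?_, ?_, ?_, ?_⟩ <;>
        field_simp <;> grind
  · have hne' : m - l ≠ 0 := fun h => hne (by linear_combination -h)
    refine ⟨b, 1 / (m - l), l - a, (m - a) / (b * (m - l)), ?_, ?_, ?_, ?_, ?_⟩ <;>
        field_simp <;> grind

theorem iterate_step_conj (P A H : SL(2, ℂ)) (n : ℕ) :
    (step (P * A * P⁻¹))^[n] (P * H * P⁻¹) = P * (step A)^[n] H * P⁻¹ := by
  induction n with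
  | zero => rfl
  | succ n ih => rw [Function.iterate_succ_apply', ih, step_conj, Function.iterate_succ_apply']

/-- The recursion of the commutator parameters for an arbitrary diagonalizable `A`. -/
theorem gam_step {A : SL(2, ℂ)} (hA : tr A ^ 2 ≠ 4) (H : SL(2, ℂ)) :
    gam A (step A H) = gam A H *
      ((gam A H - (tr A ^ 2 - 4)) * (gam A H - (tr A ^ 2 - 2)) ^ 2) := by
  obtain ⟨P, l, -, hP⟩ := exists_conj_eq_dg hA
  rw [← gam_conj P A (step A H), ← step_conj, ← gam_conj P A H, ← tr_conj P A, hP, gam_step_dg]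

theorem sq_ne_four {A H : SL(2, ℂ)} (hs : ‖gam A H‖ + ‖tr A ^ 2 - 2‖ < (√5 - 1) / 2) :
    tr A ^ 2 ≠ 4 := fun h => by
  have h5 : √5 < 3 := by rw [Real.sqrt_lt' (by norm_num)]; norm_num
  rw [h] at hs
  norm_num at hs
  linarith [norm_nonneg (gam A H)]

theorem conj_mem_comap (P : SL(2, ℂ)) {X : SL(2, ℂ)} {Γ : Subgroup SL(2, ℂ)} (hX : X ∈ Γ) :
    P * X * P⁻¹ ∈ Γ.comap (MulAut.conj P⁻¹).toMonoidHom := by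
  simpa [Subgroup.mem_comap, mul_assoc] using hX

theorem continuous_conj (P : SL(2, ℂ)) : Continuous (MulAut.conj P).toMonoidHom := by
  change Continuous fun X : SL(2, ℂ) => P * X * P⁻¹
  fun_prop

theorem discreteTopology_conj {Γ : Subgroup SL(2, ℂ)} (hΓ : DiscreteTopology Γ) (P : SL(2, ℂ)) :
    DiscreteTopology (Γ.comap (MulAut.conj P⁻¹).toMonoidHom) := by
  refine discreteTopology_comap hΓ _ (continuous_conj _) ?_
  rw [(MonoidHom.ker_eq_bot_iff _).2 (MulAut.conj P⁻¹).injective]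
  exact Set.finite_singleton 1

/-- In a discrete group, the orbit of `H` under `step A` reaches an element whose commutator with
`A` has trace `2`. -/
theorem exists_gam_eq_zero {A H : SL(2, ℂ)} {Γ : Subgroup SL(2, ℂ)}
    (hΓ : DiscreteTopology Γ) (hA : A ∈ Γ) (hH : H ∈ Γ)
    (hs : ‖gam A H‖ + ‖tr A ^ 2 - 2‖ < (√5 - 1) / 2) :
    ∃ n, gam A ((step A)^[n] H) = 0 := by
  obtain ⟨P, l, hl, hP⟩ := exists_conj_eq_dg (sq_ne_four hs)
  rw [← gam_conj P A H, ← tr_conj P A, hP] at hs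
  obtain ⟨n, hn⟩ := exists_gam_eq_zero_of_dg (discreteTopology_conj hΓ P)
    (hP ▸ conj_mem_comap P hA) (conj_mem_comap P hH) hl hs
  exact ⟨n, by rw [← gam_conj P, ← iterate_step_conj, hP, hn]⟩

/-! ### Replacing an arbitrary partner by an element of order two -/

theorem gam_eq_tr_mul_inv (A H : SL(2, ℂ)) : gam A H = tr (A * (H * A * H⁻¹)⁻¹) - 2 := by
  rw [gam_eq]; congr 2; group

theorem gam_mul_left (A H : SL(2, ℂ)) : gam (A * H) H = gam A H := by
  rw [gam_eq, gam_eq]; congr 2; group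

/-- The elements of order two in `PSL(2, ℂ)` are those of trace zero. -/
theorem mul_self_of_tr_eq_zero {φ : SL(2, ℂ)} (h : tr φ = 0) : φ * φ = -1 := by
  have hd := det_eq_one φ
  rw [tr_eq] at h
  have h' : φ 1 1 = -φ 0 0 := by linear_combination h
  rw [h'] at hd
  apply ext_entries <;>
    simp only [mul_entry, h', Matrix.SpecialLinearGroup.coe_neg,
      Matrix.SpecialLinearGroup.coe_one, Matrix.neg_apply, Matrix.one_apply_eq, ne_eq,
      zero_ne_one, one_ne_zero, not_false_eq_true, Matrix.one_apply_ne] <;> grind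

/-- If `H` does not exchange the fixed points of `A`, some element of order two conjugates `A`
in the same way as `H`. -/
theorem exists_order_two {A : SL(2, ℂ)} (hA : tr A ^ 2 ≠ 4) {H : SL(2, ℂ)}
    (hg : gam A H ≠ tr A ^ 2 - 4) : ∃ φ : SL(2, ℂ), tr φ = 0 ∧ φ * A * φ⁻¹ = H * A * H⁻¹ := by
  obtain ⟨P, l, -, hP⟩ := exists_conj_eq_dg hA
  rw [← gam_conj P A H, ← tr_conj P A, hP, gam_dg, ← sub_inv_sq] at hg
  set K := P * H * P⁻¹ with hK
  have hdet := det_eq_one K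
  have had : K 0 0 * K 1 1 ≠ 0 := fun h => hg (by
    linear_combination ((l : ℂ) - (l : ℂ)⁻¹) ^ 2 * (hdet - h))
  obtain ⟨u, hu⟩ := IsAlgClosed.exists_pow_nat_eq (-(K 1 1 / K 0 0)) (n := 2) (by norm_num)
  have ha := left_ne_zero_of_mul had
  have hd := right_ne_zero_of_mul had
  have hu0 : u ≠ 0 := by
    rintro rfl
    simp [ha, hd] at hu
  have hAl : A = P⁻¹ * dg l * P := by rw [← hP]; group
  have hH : H = P⁻¹ * K * P := by rw [hK]; group
  refine ⟨P⁻¹ * (K * dg (Units.mk0 u hu0)) * P⁻¹⁻¹, ?_, ?_⟩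
  · rw [tr_conj, tr_eq, mul_entry K _ 0 0, mul_entry K _ 1 1, dg_00, dg_01, dg_10, dg_11,
      Units.val_mk0]
    field_simp at hu ⊢
    linear_combination hu
  · have hc : dg (Units.mk0 u hu0) * dg l = dg l * dg (Units.mk0 u hu0) := by
      rw [← dg_mul, ← dg_mul, mul_comm]
    have hc' : dg (Units.mk0 u hu0) * dg l * (dg (Units.mk0 u hu0))⁻¹ = dg l := by
      rw [hc, mul_inv_cancel_right]
    rw [hAl, hH]
    calc _ = P⁻¹ * K * (dg (Units.mk0 u hu0) * dg l * (dg (Units.mk0 u hu0))⁻¹) * K⁻¹ * P := by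
          group
      _ = _ := by rw [hc']; group

/-- Adjoining to `⟨A, H A H⁻¹⟩` an element of order two that exchanges the two generators keeps
the group discrete. -/
theorem discreteTopology_closure_pair {A K φ : SL(2, ℂ)} {Γ : Subgroup SL(2, ℂ)}
    (hΓ : DiscreteTopology Γ) (hneg : -1 ∈ Γ) (hA : A ∈ Γ) (hK : K ∈ Γ) (hφ : tr φ = 0)
    (hAK : φ * A * φ⁻¹ = K) : DiscreteTopology (Subgroup.closure {A, φ}) := by
  have hφ2 := mul_self_of_tr_eq_zero hφ
  have hφinv : φ⁻¹ = -φ := by rw [inv_eq_iff_mul_eq_one, mul_neg, hφ2, neg_neg]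
  set N := Subgroup.closure ({A, K, -1} : Set SL(2, ℂ)) with hN
  have hNΓ : N ≤ Γ := by
    rw [hN, Subgroup.closure_le]
    rintro x (rfl | rfl | rfl) <;> assumption
  have hAN : A ∈ N := Subgroup.subset_closure (by simp)
  have hKN : K ∈ N := Subgroup.subset_closure (by simp)
  have h1N : -1 ∈ N := Subgroup.subset_closure (by simp)
  have hnegN : ∀ x ∈ N, -x ∈ N := fun x hx => by simpa using N.mul_mem h1N hx
  have hNd : DiscreteTopology N := by
    rw [discreteTopology_iff_eventually] at hΓ ⊢
    exact hΓ.mono fun x hx hxN => hx (hNΓ hxN)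
  have hconj : ∀ x ∈ N, φ * x * φ ∈ N := fun x hx => by
    induction hx using Subgroup.closure_induction with
    | mem x hx =>
      rcases hx with rfl | rfl | rfl
      · have : φ * x * φ = -K := by rw [← hAK, hφinv]; simp
        rw [this]; exact hnegN _ hKN
      · have : φ * x * φ = -A := by
          rw [← hAK, hφinv, mul_neg, mul_neg, neg_mul]
          congr 1
          calc _ = (φ * φ) * A * (φ * φ) := by group
            _ = A := by rw [hφ2]; simp
        rw [this]; exact hnegN _ hAN
      · simp [hφ2]
    | one => rw [mul_one, hφ2]; exact h1N
    | mul x y _ _ hx hy =>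
      have : φ * (x * y) * φ = -((φ * x * φ) * (φ * y * φ)) := by
        calc φ * (x * y) * φ = φ * x * φ * φ⁻¹ * φ⁻¹ * (φ * y * φ) := by group
          _ = _ := by
            have : φ⁻¹ * φ⁻¹ = -1 := by rw [hφinv, neg_mul_neg, hφ2]
            rw [mul_assoc (φ * x * φ), this]; simp
      rw [this]; exact hnegN _ (N.mul_mem hx hy)
    | inv x _ hx =>
      have : φ * x⁻¹ * φ = (φ * x * φ)⁻¹ := by
        rw [mul_inv_rev, mul_inv_rev, hφinv]; simp [mul_assoc]
      rw [this]; exact N.inv_mem hx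
  refine discreteTopology_of_mem_or_mul_mem φ hNd fun x hx => ?_
  induction hx using Subgroup.closure_induction with
  | mem x hx =>
    rcases hx with rfl | rfl
    · exact Or.inl hAN
    · exact Or.inr (hφ2 ▸ h1N)
  | one => exact Or.inl N.one_mem
  | mul x y _ _ hx hy =>
    rcases hx with hx | hx <;> rcases hy with hy | hy
    · exact Or.inl (N.mul_mem hx hy)
    · right
      have : φ * (x * y) = -((φ * x * φ) * (φ * y)) := by
        calc φ * (x * y) = -(φ * x * (-1) * y) := by simp [mul_assoc]
          _ = _ := by rw [← hφ2]; congr 1; group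
      rw [this]; exact hnegN _ (N.mul_mem (hconj x hx) hy)
    · right; rw [← mul_assoc]; exact N.mul_mem hx hy
    · left
      have : x * y = φ * (φ * x) * φ * (φ * y) := by
        calc x * y = (-1) * x * (-1) * y := by simp
          _ = _ := by rw [← hφ2]; group
      rw [this]; exact N.mul_mem (hconj _ hx) hy
  | inv x _ hx =>
    rcases hx with hx | hx
    · exact Or.inl (N.inv_mem hx)
    · right
      have : φ * x⁻¹ = φ * (φ * x)⁻¹ * φ := by group
      rw [this]; exact hconj _ (N.inv_mem hx)

/-- In a discrete subgroup of `SL(2, ℂ)`, a pair whose first member is nearly of order four and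
whose commutator parameter is small has commutator parameter `0`, so it is reducible. -/
theorem gam_eq_zero_of_discrete {A B : SL(2, ℂ)} {Γ : Subgroup SL(2, ℂ)}
    (hΓ : DiscreteTopology Γ) (hneg : -1 ∈ Γ) (hA : A ∈ Γ) (hB : B ∈ Γ)
    (hs : ‖gam A B‖ + ‖tr A ^ 2 - 2‖ < (√5 - 1) / 2) : gam A B = 0 := by
  classical
  by_contra hne
  have h5 : √5 < 3 := by rw [Real.sqrt_lt' (by norm_num)]; norm_num
  have h4 := sq_ne_four hs
  have hex := exists_gam_eq_zero hΓ hA hB hs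
  obtain ⟨k, hk⟩ : ∃ k, Nat.find hex = k + 1 :=
    Nat.exists_eq_succ_of_ne_zero fun h0 => hne (by simpa [h0] using Nat.find_spec hex)
  have hk1 := Nat.find_spec hex
  have hk0 := Nat.find_min hex (m := k) (by omega)
  rw [hk, Function.iterate_succ_apply', gam_step h4] at hk1
  have hle := (tendsto_zero_of_recursion (g := fun n => gam A ((step A)^[n] B)) (x := tr A ^ 2)
    (fun n => by rw [Function.iterate_succ_apply', gam_step h4]) hs).1 k
  have hmem : ∀ n, (step A)^[n] B ∈ Γ := fun n => by
    induction n with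
    | zero => exact hB
    | succ n ih => rw [Function.iterate_succ_apply']; exact step_mem hA ih
  have hHmem := hmem k
  generalize (step A)^[k] B = H at *
  simp only [Function.iterate_zero_apply] at hle
  have hβ : gam A H ≠ tr A ^ 2 - 4 := fun h => by
    have h1 : (2 : ℂ) = (tr A ^ 2 - 2) - gam A H := by rw [h]; ring
    have h2 := norm_sub_le (tr A ^ 2 - 2) (gam A H)
    rw [← h1] at h2
    norm_num at h2
    linarith
  have hγ : gam A H = tr A ^ 2 - 2 := by
    simpa [hk0, sub_ne_zero.2 hβ, sub_eq_zero] using hk1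
  -- Here `A H A H⁻¹` has order two, and the iteration stops. With `φ` in place of `H`, the product
  -- `A φ` has order four, and the iteration based at `A φ` never stops.
  obtain ⟨φ, hφ, hconj⟩ := exists_order_two h4 hβ
  have hgφ : gam A φ = tr A ^ 2 - 2 := by
    rw [gam_eq_tr_mul_inv, hconj, ← gam_eq_tr_mul_inv, hγ]
  have hΛ := discreteTopology_closure_pair hΓ hneg hA
    (Γ.mul_mem (Γ.mul_mem hHmem hA) (Γ.inv_mem hHmem)) hφ hconj
  have htr : tr (A * φ) ^ 2 = 2 := by rw [tr_mul_sq A φ hφ, hgφ]; ring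
  have hg0 : gam (A * φ) φ = tr A ^ 2 - 2 := by rw [gam_mul_left, hgφ]
  have hs' : ‖gam (A * φ) φ‖ + ‖tr (A * φ) ^ 2 - 2‖ < (√5 - 1) / 2 := by
    rw [htr, hg0]
    simpa using lt_of_le_of_lt (by simp) hs
  obtain ⟨n, hn⟩ := exists_gam_eq_zero hΛ
    (Subgroup.mul_mem _ (Subgroup.subset_closure (by simp)) (Subgroup.subset_closure (by simp)))
    (Subgroup.subset_closure (by simp)) hs'
  have hrec : ∀ n, gam (A * φ) ((step (A * φ))^[n + 1] φ) = _ := fun n => by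
    rw [Function.iterate_succ_apply', gam_step (by rw [htr]; norm_num), htr]
  have hle' := (tendsto_zero_of_recursion
    (g := fun n => gam (A * φ) ((step (A * φ))^[n] φ)) (x := tr (A * φ) ^ 2)
    (fun n => by rw [hrec, htr]) hs').1
  refine absurd hn ?_
  clear hn
  induction n with
  | zero => rw [Function.iterate_zero_apply, hg0, ← hγ]; exact hk0
  | succ n ih =>
    rw [hrec]
    have h2 := hle' n
    simp only [Function.iterate_zero_apply] at h2
    generalize gam (A * φ) ((step (A * φ))^[n] φ) = g at *
    have hg2 : g - (2 - 4) ≠ 0 := fun h => by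
      have : g = -2 := by linear_combination h
      rw [this] at h2
      norm_num at h2
      linarith [norm_nonneg (tr (A * φ) ^ 2 - 2)]
    exact mul_ne_zero ih (mul_ne_zero hg2 (pow_ne_zero _ (by simpa using ih)))

/-! ### Reducible pairs generate virtually abelian groups -/

theorem IsVirtuallyAbelian.of_surjective {H H' : Type*} [Group H] [Group H']
    (hH : IsVirtuallyAbelian H) (Φ : H →* H') (hΦ : Function.Surjective Φ) :
    IsVirtuallyAbelian H' := by
  obtain ⟨K, hK, hcomm⟩ := hH
  refine ⟨K.map Φ, ⟨fun h => hK.index_ne_zero ?_⟩, ?_⟩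
  · exact zero_dvd_iff.1 (h ▸ Subgroup.index_map_dvd K hΦ)
  · rintro _ ⟨x, hx, rfl⟩ _ ⟨y, hy, rfl⟩
    rw [← map_mul, ← map_mul, hcomm x hx y hy]

section Triangular

variable {l : ℂˣ} {B : SL(2, ℂ)}

theorem lower_eq_zero (hB : B 1 0 = 0) {x : SL(2, ℂ)}
    (hx : x ∈ Subgroup.closure ({dg l, B} : Set SL(2, ℂ))) : x 1 0 = 0 := by
  induction hx using Subgroup.closure_induction with
  | mem x hx => rcases hx with rfl | rfl; exacts [dg_10 l, hB]
  | one => simp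
  | mul x y _ _ hx hy => rw [mul_entry, hx, hy]; ring
  | inv x _ hx => rw [inv_10, hx, neg_zero]

theorem upper_eq_zero (hB : B 0 1 = 0) {x : SL(2, ℂ)}
    (hx : x ∈ Subgroup.closure ({dg l, B} : Set SL(2, ℂ))) : x 0 1 = 0 := by
  induction hx using Subgroup.closure_induction with
  | mem x hx => rcases hx with rfl | rfl; exacts [dg_01 l, hB]
  | one => simp
  | mul x y _ _ hx hy => rw [mul_entry, hx, hy]; ring
  | inv x _ hx => rw [inv_01, hx, neg_zero]

theorem pow_eq_one_of_mem_closure (hB : B 1 0 = 0) {N : ℕ} (hl : (l : ℂ) ^ N = 1)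
    (hBN : B 0 0 ^ N = 1) {x : SL(2, ℂ)}
    (hx : x ∈ Subgroup.closure ({dg l, B} : Set SL(2, ℂ))) : x 0 0 ^ N = 1 := by
  induction hx using Subgroup.closure_induction with
  | mem x hx => rcases hx with rfl | rfl; exacts [hl, hBN]
  | one => simp
  | mul x y _ hy' hx hy =>
    rw [mul_entry, lower_eq_zero hB hy', mul_zero, add_zero, mul_pow, hx, hy, one_mul]
  | inv x hx' hx =>
    have h := det_eq_one x
    rw [lower_eq_zero hB hx', mul_zero, sub_zero] at h
    have h' := congrArg (· ^ N) h
    simp only [mul_pow, hx, one_mul, one_pow] at h'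
    rw [inv_00, h']

/-- A loxodromic diagonal matrix would conjugate a parabolic commutator arbitrarily close
to `1`. -/
theorem norm_eq_one_of_discrete {Γ : Subgroup SL(2, ℂ)} (hΓ : DiscreteTopology Γ)
    (hD : dg l ∈ Γ) (hB : B ∈ Γ) (h10 : B 1 0 = 0) (h01 : B 0 1 ≠ 0) (hl : (l : ℂ) ^ 2 ≠ 1) :
    ‖(l : ℂ)‖ = 1 := by
  by_contra hne
  obtain ⟨v, hv, hv1⟩ : ∃ v : ℂˣ, dg v ∈ Γ ∧ ‖(v : ℂ)‖ < 1 := by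
    rcases lt_or_gt_of_ne hne with h | h
    · exact ⟨l, hD, h⟩
    · refine ⟨l⁻¹, ?_, ?_⟩
      · have : dg l⁻¹ = (dg l)⁻¹ := map_inv dgHom l
        rw [this]; exact Γ.inv_mem hD
      · rw [Units.val_inv_eq_inv_val, norm_inv]
        exact inv_lt_one_of_one_lt₀ h
  have hdet := det_eq_one B
  rw [h10, mul_zero, sub_zero] at hdet
  set y : SL(2, ℂ) := dg l * B * (dg l)⁻¹ * B⁻¹ with hy
  have hy00 : y 0 0 = 1 := by
    rw [hy, mul_entry, inv_00, inv_10, h10, dg_conj_00]; linear_combination hdet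
  have hy11 : y 1 1 = 1 := by
    rw [hy, mul_entry, inv_01, inv_11, dg_conj_11, dg_conj_10, h10]; linear_combination hdet
  have hy10 : y 1 0 = 0 := by
    rw [hy, mul_entry, inv_00, inv_10, dg_conj_11, dg_conj_10, h10]; ring
  have hy01 : y 0 1 = ((l : ℂ) ^ 2 - 1) * (B 0 0 * B 0 1) := by
    rw [hy, mul_entry, inv_01, inv_11, dg_conj_00, dg_conj_01]; ring
  have hy01' : y 0 1 ≠ 0 := by
    rw [hy01]
    exact mul_ne_zero (sub_ne_zero.2 hl) (mul_ne_zero (left_ne_zero_of_mul_eq_one hdet) h01)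
  have hyΓ : y ∈ Γ :=
    Γ.mul_mem (Γ.mul_mem (Γ.mul_mem hD hB) (Γ.inv_mem hD)) (Γ.inv_mem hB)
  have hdg : ∀ k : ℕ, dg (v ^ k) ∈ Γ := fun k => by rw [dg_pow]; exact Γ.pow_mem hv k
  have hlim : Tendsto (fun k : ℕ => dg (v ^ k) * y * (dg (v ^ k))⁻¹) atTop (𝓝 1) := by
    apply tendsto_of_entries
    · simp only [dg_conj_00, hy00]; simp
    · simp only [dg_conj_01, Units.val_pow_eq_pow_val]
      have := ((tendsto_pow_atTop_nhds_zero_of_norm_lt_one hv1).pow 2).mul_const (y 0 1)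
      simpa using this
    · simp only [dg_conj_10, hy10]; simp
    · simp only [dg_conj_11, hy11]; simp
  obtain ⟨k, hk⟩ := (eventually_eq_of_tendsto hΓ
    (fun k => Γ.mul_mem (Γ.mul_mem (hdg k) hyΓ) (Γ.inv_mem (hdg k))) Γ.one_mem hlim).exists
  have h := dg_conj_01 (v ^ k) y
  rw [hk] at h
  have h' : ((v ^ k : ℂˣ) : ℂ) ^ 2 * y 0 1 = 0 := by rw [← h]; simp
  exact hy01' ((mul_eq_zero.1 h').resolve_left (pow_ne_zero _ (Units.ne_zero _)))

/-- The powers of an elliptic element accumulate at `1`, so in a discrete group it has finite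
order. -/
theorem exists_pow_eq_one_of_discrete {Γ : Subgroup SL(2, ℂ)} (hΓ : DiscreteTopology Γ)
    (hD : dg l ∈ Γ) (hl : ‖(l : ℂ)‖ = 1) : ∃ n, 0 < n ∧ (l : ℂ) ^ n = 1 := by
  obtain ⟨a, ha, φ, hφ, hlim⟩ := tendsto_subseq_of_bounded (s := Metric.sphere (0 : ℂ) 1)
    Metric.isBounded_sphere (x := fun n => (l : ℂ) ^ n) (fun n => by simp [hl])
  have ha0 : a ≠ 0 := by
    rw [Metric.isClosed_sphere.closure_eq] at ha
    rintro rfl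
    simp at ha
  have h1 : Tendsto (fun k => ((l ^ (φ (k + 1) - φ k) : ℂˣ) : ℂ)) atTop (𝓝 1) := by
    have := (hlim.comp (tendsto_add_atTop_nat 1)).div hlim ha0
    rw [div_self ha0] at this
    refine this.congr fun k => ?_
    simp only [Function.comp, Pi.div_apply, Units.val_pow_eq_pow_val]
    rw [pow_sub₀ _ (Units.ne_zero l) (hφ (Nat.lt_succ_self k)).le, div_eq_mul_inv]
  have h2 : Tendsto (fun k => dg (l ^ (φ (k + 1) - φ k))) atTop (𝓝 1) := by
    apply tendsto_of_entries
    · simp only [dg_00]; simpa using h1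
    · simp only [dg_01]; simp
    · simp only [dg_10]; simp
    · simpa [dg_11] using h1.inv₀ one_ne_zero
  obtain ⟨k, hk⟩ := (eventually_eq_of_tendsto hΓ
    (fun k => by rw [dg_pow]; exact Γ.pow_mem hD _) Γ.one_mem h2).exists
  refine ⟨φ (k + 1) - φ k, Nat.sub_pos_of_lt (hφ (Nat.lt_succ_self k)), ?_⟩
  have := dg_00 (l ^ (φ (k + 1) - φ k))
  rw [hk] at this
  simpa using this.symm

theorem finite_range_of_pow_eq_one {Λ : Type*} [Group Λ] {χ : Λ →* ℂˣ} {n : ℕ} (hn : 0 < n)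
    (h : ∀ x, χ x ^ n = 1) : Finite χ.range := by
  have : NeZero n := ⟨hn.ne'⟩
  have hle : χ.range ≤ rootsOfUnity n ℂ := by
    rintro _ ⟨x, rfl⟩
    exact (mem_rootsOfUnity _ _).2 (h x)
  exact Finite.of_injective _ (Subgroup.inclusion_injective hle)

/-- A discrete group generated by `diag(l, l⁻¹)` and an upper triangular element of order two is
a finite extension of a group of translations, or consists of diagonal matrices. -/
theorem isVirtuallyAbelian_of_triangular {Γ : Subgroup SL(2, ℂ)} (hΓ : DiscreteTopology Γ)
    (hD : dg l ∈ Γ) (hB : B ∈ Γ) (h10 : B 1 0 = 0) (htr : tr B = 0) (hl : (l : ℂ) ^ 2 ≠ 1) :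
    IsVirtuallyAbelian (Subgroup.closure ({dg l, B} : Set SL(2, ℂ))) := by
  set Λ := Subgroup.closure ({dg l, B} : Set SL(2, ℂ)) with hΛ
  by_cases h01 : B 0 1 = 0
  · refine ⟨⊤, inferInstance, fun x _ y _ => Subtype.ext ?_⟩
    have hx1 := lower_eq_zero h10 x.2
    have hx2 := upper_eq_zero h01 x.2
    have hy1 := lower_eq_zero h10 y.2
    have hy2 := upper_eq_zero h01 y.2
    simp only [Subgroup.coe_mul]
    apply ext_entries <;> simp only [mul_entry, hx1, hx2, hy1, hy2] <;> ring
  · have hl1 := norm_eq_one_of_discrete hΓ hD hB h10 h01 hl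
    obtain ⟨n, hn, hln⟩ := exists_pow_eq_one_of_discrete hΓ hD hl1
    have hB4 : B 0 0 ^ 4 = 1 := by
      have hdet := det_eq_one B
      rw [tr_eq] at htr
      have h2 : B 0 0 ^ 2 = -1 := by
        linear_combination (B 0 0) * htr - hdet - B 0 1 * h10
      linear_combination (B 0 0 ^ 2 - 1) * h2
    -- The upper left entry is a character of finite order whose kernel is unipotent.
    let χ₀ : Λ →* ℂ :=
      { toFun := fun x => (x : SL(2, ℂ)) 0 0
        map_one' := by simp
        map_mul' := fun x y => by
          rw [Subgroup.coe_mul, mul_entry, lower_eq_zero h10 y.2]; ring }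
    let χ : Λ →* ℂˣ := χ₀.toHomUnits
    have hχ : ∀ x : Λ, ((χ x : ℂˣ) : ℂ) = (x : SL(2, ℂ)) 0 0 := fun x => rfl
    have hpow : ∀ x : Λ, χ x ^ (4 * n) = 1 := fun x => Units.ext (by
      rw [Units.val_pow_eq_pow_val, hχ, Units.val_one]
      exact pow_eq_one_of_mem_closure h10 (by rw [mul_comm, pow_mul, hln, one_pow])
        (by rw [pow_mul, hB4, one_pow]) x.2)
    have hfin : Finite χ.range := finite_range_of_pow_eq_one (by omega) hpow
    refine ⟨χ.ker, Subgroup.finiteIndex_ker χ, fun x hx y hy => Subtype.ext ?_⟩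
    have key : ∀ z : Λ, z ∈ χ.ker → (z : SL(2, ℂ)) 0 0 = 1 ∧ (z : SL(2, ℂ)) 1 0 = 0 ∧
        (z : SL(2, ℂ)) 1 1 = 1 := fun z hz => by
      have h1 : (z : SL(2, ℂ)) 0 0 = 1 := by rw [← hχ, MonoidHom.mem_ker.1 hz]; rfl
      have h2 := lower_eq_zero h10 z.2
      have h3 := det_eq_one (z : SL(2, ℂ))
      rw [h1, h2] at h3
      exact ⟨h1, h2, by linear_combination h3⟩
    obtain ⟨hx1, hx2, hx3⟩ := key x hx
    obtain ⟨hy1, hy2, hy3⟩ := key y hy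
    simp only [Subgroup.coe_mul]
    apply ext_entries <;> simp only [mul_entry, hx1, hx2, hx3, hy1, hy2, hy3] <;> ring

end Triangular

/-! ### The inequality -/

theorem center_finite : (Subgroup.center SL(2, ℂ) : Set SL(2, ℂ)).Finite := by
  refine (Set.toFinite {1, -1}).subset fun x hx => ?_
  refine eq_or_eq_neg (A := 1) (B := x) (QuotientGroup.eq.2 ?_)
  simpa using hx

theorem neg_one_mem_center : (-1 : SL(2, ℂ)) ∈ Subgroup.center SL(2, ℂ) :=
  Subgroup.mem_center_iff.2 fun g => by simp

theorem continuous_mk' : Continuous (QuotientGroup.mk' (Subgroup.center SL(2, ℂ))) :=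
  QuotientGroup.continuous_mk

/-- A pair whose commutator has trace `2` is simultaneously triangularizable. -/
theorem exists_conj_triangular {A B : SL(2, ℂ)} (hA : tr A ^ 2 ≠ 4) (h : gam A B = 0) :
    ∃ (P : SL(2, ℂ)) (l : ℂˣ), P * A * P⁻¹ = dg l ∧ (P * B * P⁻¹) 1 0 = 0 := by
  obtain ⟨P, l, -, hP⟩ := exists_conj_eq_dg hA
  have hne : ((l : ℂ) - (l : ℂ)⁻¹) ^ 2 ≠ 0 := by
    rw [sub_inv_sq, ← hP, tr_conj]; exact sub_ne_zero.2 hA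
  rw [← gam_conj P, hP, gam_dg] at h
  rcases mul_eq_zero.1 ((mul_eq_zero.1 h).resolve_left (neg_ne_zero.2 hne)) with h | h
  · refine ⟨mk2 0 1 (-1) 0 (by ring) * P, l⁻¹, ?_, ?_⟩
    · have : mk2 0 1 (-1) 0 (by ring) * P * A * (mk2 0 1 (-1) 0 (by ring) * P)⁻¹ =
          mk2 0 1 (-1) 0 (by ring) * (P * A * P⁻¹) * (mk2 0 1 (-1) 0 (by ring))⁻¹ := by group
      rw [this, hP]
      apply ext_entries <;>
        simp [mul_entry, mk2_00, mk2_01, mk2_10, mk2_11, dg_00, dg_01, dg_10, dg_11, inv_00,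
          inv_01, inv_10, inv_11]
    · have : mk2 0 1 (-1) 0 (by ring) * P * B * (mk2 0 1 (-1) 0 (by ring) * P)⁻¹ =
          mk2 0 1 (-1) 0 (by ring) * (P * B * P⁻¹) * (mk2 0 1 (-1) 0 (by ring))⁻¹ := by group
      rw [this]
      generalize P * B * P⁻¹ = C at *
      simp [mul_entry, mk2_10, mk2_11, inv_00, inv_10, h]
  · exact ⟨P, l, hP, h⟩

/-- A Kleinian pair is not reducible, so its parameters stay away from those of the reducible
pairs. -/
theorem inequality_of_isKleinian {f g : PSL(2, ℂ)} {γ β : ℂ}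
    (hK : IsKleinian (Subgroup.closure {f, g})) (hpc : principalCharacter f g = (γ, β, -4)) :
    (√5 - 1) / 2 ≤ ‖γ‖ + ‖β + 2‖ := by
  by_contra! hlt
  obtain ⟨hdisc, hva⟩ := hK
  obtain ⟨A, rfl⟩ := QuotientGroup.mk_surjective f
  obtain ⟨B, rfl⟩ := QuotientGroup.mk_surjective g
  simp only [principalCharacter, Prod.mk.injEq, beta_coe, gamma_coe] at hpc
  obtain ⟨hγ, hβ, hB⟩ := hpc
  have htrB : tr B = 0 := by
    have : tr B ^ 2 = 0 := by unfold tr; linear_combination hB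
    exact pow_eq_zero_iff (two_ne_zero) |>.1 this
  have hs : ‖gam A B‖ + ‖tr A ^ 2 - 2‖ < (√5 - 1) / 2 := by
    have h1 : gam A B = γ := hγ
    have h2 : tr A ^ 2 - 2 = β + 2 := by unfold tr; linear_combination hβ
    rwa [h1, h2]
  set G := Subgroup.closure {(A : PSL(2, ℂ)), (B : PSL(2, ℂ))} with hG
  set π := QuotientGroup.mk' (Subgroup.center SL(2, ℂ)) with hπ
  have hπker : π.ker = Subgroup.center SL(2, ℂ) := QuotientGroup.ker_mk' _
  have hΓ : DiscreteTopology (G.comap π) :=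
    discreteTopology_comap hdisc π continuous_mk' (by rw [hπker]; exact center_finite)
  have hAΓ : A ∈ G.comap π := Subgroup.subset_closure (by simp [hπ])
  have hBΓ : B ∈ G.comap π := Subgroup.subset_closure (by simp [hπ])
  have hneg : -1 ∈ G.comap π := by
    have : π (-1) = 1 := by rw [← MonoidHom.mem_ker, hπker]; exact neg_one_mem_center
    rw [Subgroup.mem_comap, this]; exact G.one_mem
  have h0 := gam_eq_zero_of_discrete hΓ hneg hAΓ hBΓ hs
  obtain ⟨P, l, hP, hPB⟩ := exists_conj_triangular (sq_ne_four hs) h0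
  have hl : (l : ℂ) ^ 2 ≠ 1 := fun h => sq_ne_four hs (by
    have hinv : (l : ℂ)⁻¹ ^ 2 = 1 := by rw [inv_pow, h, inv_one]
    rw [← tr_conj P A, hP, tr_dg_sq, h, hinv]; norm_num)
  have hvab := isVirtuallyAbelian_of_triangular (discreteTopology_conj hΓ P)
    (hP ▸ conj_mem_comap P hAΓ) (conj_mem_comap P hBΓ) hPB (by rw [tr_conj, htrB]) hl
  refine hva ?_
  have hmap : (Subgroup.closure ({dg l, P * B * P⁻¹} : Set SL(2, ℂ))).map
      (π.comp (MulAut.conj P⁻¹).toMonoidHom) = G := by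
    rw [MonoidHom.map_closure, Set.image_pair, ← hP, hG]
    simp [hπ, mul_assoc]
  rw [← hmap]
  exact hvab.of_surjective (MonoidHom.subgroupMap _ _) (MonoidHom.subgroupMap_surjective _ _)

/-! ### The ring of golden integers -/

open Real (goldenRatio goldenConj)

/-- The ring `ℤ[φ]`, embedded in `ℝ × ℝ` by its two real places. -/
def goldenIntegers : Subring (ℝ × ℝ) where
  carrier := {x | ∃ m n : ℤ, x = (m + n * goldenRatio, m + n * goldenConj)}
  zero_mem' := ⟨0, 0, by simp; rfl⟩
  one_mem' := ⟨1, 0, by simp; rfl⟩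
  add_mem' := by
    rintro _ _ ⟨m, n, rfl⟩ ⟨m', n', rfl⟩
    refine ⟨m + m', n + n', Prod.ext ?_ ?_⟩ <;> push_cast <;> simp only [Prod.mk_add_mk] <;> ring
  neg_mem' := by
    rintro _ ⟨m, n, rfl⟩
    refine ⟨-m, -n, Prod.ext ?_ ?_⟩ <;> push_cast <;> simp only [Prod.neg_mk] <;> ring
  mul_mem' := by
    rintro _ _ ⟨m, n, rfl⟩ ⟨m', n', rfl⟩
    refine ⟨m * m' + n * n', m * n' + n * m' + n * n', Prod.ext ?_ ?_⟩ <;> push_cast <;>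
      simp only [Prod.mk_mul_mk]
    · linear_combination (n * n' : ℝ) * Real.goldenRatio_sq
    · linear_combination (n * n' : ℝ) * Real.goldenConj_sq

/-- The golden ratio as an element of `ℝ × ℝ`. -/
def gold : ℝ × ℝ := (goldenRatio, goldenConj)

theorem gold_mem : gold ∈ goldenIntegers := ⟨0, 1, by simp [gold]⟩

theorem exists_int_eq_norm {x : ℝ × ℝ} (hx : x ∈ goldenIntegers) : ∃ k : ℤ, x.1 * x.2 = k := by
  obtain ⟨m, n, rfl⟩ := hx
  refine ⟨m ^ 2 + m * n - n ^ 2, ?_⟩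
  push_cast
  linear_combination (m * n : ℝ) * Real.goldenRatio_add_goldenConj +
    (n ^ 2 : ℝ) * Real.goldenRatio_mul_goldenConj

theorem int_eq_zero_of_add_mul_irrational {a : ℝ} (ha : Irrational a) {m n : ℤ}
    (h : m + n * a = 0) : m = 0 ∧ n = 0 := by
  by_cases hn : n = 0
  · subst hn
    simpa using h
  · exact absurd h (by
      simpa using ((ha.intCast_mul hn).intCast_add m).ne_zero)

/-- A golden integer whose norm has absolute value below `1` vanishes at both places. -/
theorem eq_zero_of_abs_mul_lt_one {x : ℝ × ℝ} (hx : x ∈ goldenIntegers)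
    (h : |x.1| * |x.2| < 1) : x = 0 := by
  obtain ⟨k, hk⟩ := exists_int_eq_norm hx
  rw [← abs_mul, hk, ← Int.cast_abs] at h
  have hk0 : k = 0 := Int.abs_lt_one_iff.1 (by exact_mod_cast h)
  rw [hk0, Int.cast_zero] at hk
  obtain ⟨m, n, rfl⟩ := hx
  have : m = 0 ∧ n = 0 := by
    rcases mul_eq_zero.1 hk with h | h
    · exact int_eq_zero_of_add_mul_irrational Real.goldenRatio_irrational h
    · exact int_eq_zero_of_add_mul_irrational Real.goldenConj_irrational h
  rw [this.1, this.2]; simp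

theorem eq_zero_of_fst_eq_zero {x : ℝ × ℝ} (hx : x ∈ goldenIntegers) (h : x.1 = 0) : x = 0 :=
  eq_zero_of_abs_mul_lt_one hx (by simp [h])

/-! ### The generators of the triangle group -/

/-- The positive square root of `φ - 1`. -/
def gap : ℝ := √(goldenRatio - 1)

theorem gap_sq : gap ^ 2 = goldenRatio - 1 :=
  Real.sq_sqrt (by linarith [Real.one_lt_goldenRatio])

theorem goldenRatio_lt : goldenRatio < 1.62 := by
  have : √5 < 2.24 := by rw [Real.sqrt_lt' (by norm_num)]; norm_num
  rw [goldenRatio]; linarith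

theorem lt_goldenRatio : 1.61 < goldenRatio := by
  have : 2.22 < √5 := by rw [Real.lt_sqrt (by norm_num)]; norm_num
  rw [goldenRatio]; linarith

theorem gap_bounds : 1 / 2 < gap ∧ gap < 1 := by
  have h0 : 0 ≤ gap := Real.sqrt_nonneg _
  have := gap_sq
  constructor <;> nlinarith [goldenRatio_lt, lt_goldenRatio]

/-- The larger root of `X² - φ X + 1/2`. -/
def rootU : ℝ := (goldenRatio + gap) / 2

/-- The smaller root of `X² - φ X + 1/2`. -/
def rootV : ℝ := (goldenRatio - gap) / 2

theorem rootU_add_rootV : rootU + rootV = goldenRatio := by rw [rootU, rootV]; ring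

theorem rootU_sub_rootV : rootU - rootV = gap := by rw [rootU, rootV]; ring

theorem rootU_mul_rootV : rootU * rootV = 1 / 2 := by
  rw [rootU, rootV]; linear_combination (Real.goldenRatio_sq - gap_sq) / 4

theorem sqrt_two_sq : √2 ^ 2 = (2 : ℝ) := Real.sq_sqrt (by norm_num)

/-- The rotation through `π / 2` about the point `i √2 rootU`. -/
def genA : SL(2, ℝ) := mk2 (√2 / 2) rootU (-rootV) (√2 / 2)
  (by linear_combination sqrt_two_sq / 4 + rootU_mul_rootV)

/-- The rotation through `π` about `i`. -/
def genB : SL(2, ℝ) := mk2 0 (-1) 1 0 (by ring)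

/-- The entries of `w` are those of `P + Q A + R B + S A B`, where `A` and `B` are the
generators. -/
structure HasCoords (w : SL(2, ℝ)) (P Q R S : ℝ) : Prop where
  h00 : w 0 0 = P + Q * (√2 / 2) + S * rootU
  h01 : w 0 1 = Q * rootU - R - S * (√2 / 2)
  h10 : w 1 0 = -Q * rootV + R + S * (√2 / 2)
  h11 : w 1 1 = P + Q * (√2 / 2) + S * rootV

theorem HasCoords.mul_genA {w : SL(2, ℝ)} {P Q R S : ℝ} (h : HasCoords w P Q R S) :
    HasCoords (w * genA) (-Q + goldenRatio * R) (P + √2 * Q + goldenRatio * S) (√2 * R + S)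
      (-R) := by
  have h2 := sqrt_two_sq
  have h3 := rootU_mul_rootV
  constructor <;> simp only [mul_entry, genA, mk2_00, mk2_01, mk2_10, mk2_11, h.h00, h.h01, h.h10,
    h.h11, ← rootU_add_rootV] <;> grind

theorem HasCoords.mul_genB {w : SL(2, ℝ)} {P Q R S : ℝ} (h : HasCoords w P Q R S) :
    HasCoords (w * genB) (-R) (-S) P Q := by
  constructor <;> simp only [mul_entry, genB, mk2_00, mk2_01, mk2_10, mk2_11, h.h00, h.h01, h.h10,
    h.h11] <;> grind [sqrt_two_sq, rootU_mul_rootV]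

theorem HasCoords.mul_genA_inv {w : SL(2, ℝ)} {P Q R S : ℝ} (h : HasCoords w P Q R S) :
    HasCoords (w * genA⁻¹) (√2 * P + Q - goldenRatio * R) (-P - goldenRatio * S) (-S)
      (√2 * S + R) := by
  have h2 := sqrt_two_sq
  have h3 := rootU_mul_rootV
  constructor <;> simp only [mul_entry, inv_00, inv_01, inv_10, inv_11, genA, mk2_00, mk2_01,
    mk2_10, mk2_11, h.h00, h.h01, h.h10, h.h11, ← rootU_add_rootV] <;> grind

theorem HasCoords.mul_genB_inv {w : SL(2, ℝ)} {P Q R S : ℝ} (h : HasCoords w P Q R S) :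
    HasCoords (w * genB⁻¹) R S (-P) (-Q) := by
  constructor <;> simp only [mul_entry, inv_00, inv_01, inv_10, inv_11, genB, mk2_00, mk2_01,
    mk2_10, mk2_11, h.h00, h.h01, h.h10, h.h11] <;> grind [sqrt_two_sq, rootU_mul_rootV]

/-- The determinant in the coordinates with respect to `1, A, B, A B`. -/
theorem HasCoords.norm_eq_one {w : SL(2, ℝ)} {P Q R S : ℝ} (h : HasCoords w P Q R S) :
    P ^ 2 + Q ^ 2 + R ^ 2 + S ^ 2 + √2 * (P * Q + R * S) + goldenRatio * (P * S - Q * R) = 1 := by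
  have hd := det_eq_one w
  rw [h.h00, h.h01, h.h10, h.h11] at hd
  have h2 := sqrt_two_sq
  have h3 := rootU_mul_rootV
  rw [← rootU_add_rootV]
  grind

/-! ### Discreteness of the triangle group -/

open Real (goldenRatio goldenConj)

/-- Matrices `p + q √2 A + r √2 B + s A B` with `p, q, r, s ∈ ℤ[φ]`; every word of even length in
the generators has this form. -/
def IsEvenWord (w : SL(2, ℝ)) : Prop :=
  ∃ p ∈ goldenIntegers, ∃ q ∈ goldenIntegers, ∃ r ∈ goldenIntegers, ∃ s ∈ goldenIntegers,
    HasCoords w p.1 (√2 * q.1) (√2 * r.1) s.1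

/-- Matrices `p √2 + q A + r B + s √2 A B` with `p, q, r, s ∈ ℤ[φ]`; every word of odd length in
the generators has this form. -/
def IsOddWord (w : SL(2, ℝ)) : Prop :=
  ∃ p ∈ goldenIntegers, ∃ q ∈ goldenIntegers, ∃ r ∈ goldenIntegers, ∃ s ∈ goldenIntegers,
    HasCoords w (√2 * p.1) q.1 r.1 (√2 * s.1)

theorem HasCoords.of_eq {w : SL(2, ℝ)} {P Q R S P' Q' R' S' : ℝ} (h : HasCoords w P Q R S)
    (hP : P = P') (hQ : Q = Q') (hR : R = R') (hS : S = S') : HasCoords w P' Q' R' S' := by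
  subst hP hQ hR hS; exact h

section Words

variable {w : SL(2, ℝ)}

theorem IsEvenWord.mul_genA (h : IsEvenWord w) : IsOddWord (w * genA) := by
  obtain ⟨p, hp, q, hq, r, hr, s, hs, h⟩ := h
  have h2 := sqrt_two_sq
  refine ⟨-q + gold * r, add_mem (neg_mem hq) (mul_mem gold_mem hr),
    p + (q + q) + gold * s, add_mem (add_mem hp (add_mem hq hq)) (mul_mem gold_mem hs),
    r + r + s, add_mem (add_mem hr hr) hs, -r, neg_mem hr, h.mul_genA.of_eq ?_ ?_ ?_ ?_⟩ <;>
    simp only [Prod.fst_add, Prod.fst_neg, Prod.fst_mul, gold] <;> grind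

theorem IsOddWord.mul_genA (h : IsOddWord w) : IsEvenWord (w * genA) := by
  obtain ⟨p, hp, q, hq, r, hr, s, hs, h⟩ := h
  have h2 := sqrt_two_sq
  refine ⟨-q + gold * r, add_mem (neg_mem hq) (mul_mem gold_mem hr),
    p + q + gold * s, add_mem (add_mem hp hq) (mul_mem gold_mem hs),
    r + s, add_mem hr hs, -r, neg_mem hr, h.mul_genA.of_eq ?_ ?_ ?_ ?_⟩ <;>
    simp only [Prod.fst_add, Prod.fst_neg, Prod.fst_mul, gold] <;> grind

theorem IsEvenWord.mul_genA_inv (h : IsEvenWord w) : IsOddWord (w * genA⁻¹) := by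
  obtain ⟨p, hp, q, hq, r, hr, s, hs, h⟩ := h
  have h2 := sqrt_two_sq
  refine ⟨p + q - gold * r, sub_mem (add_mem hp hq) (mul_mem gold_mem hr),
    -p - gold * s, sub_mem (neg_mem hp) (mul_mem gold_mem hs),
    -s, neg_mem hs, s + r, add_mem hs hr, h.mul_genA_inv.of_eq ?_ ?_ ?_ ?_⟩ <;>
    simp only [Prod.fst_add, Prod.fst_neg, Prod.fst_mul, Prod.fst_sub, gold] <;> grind

theorem IsOddWord.mul_genA_inv (h : IsOddWord w) : IsEvenWord (w * genA⁻¹) := by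
  obtain ⟨p, hp, q, hq, r, hr, s, hs, h⟩ := h
  have h2 := sqrt_two_sq
  refine ⟨p + p + q - gold * r,
    sub_mem (add_mem (add_mem hp hp) hq) (mul_mem gold_mem hr),
    -p - gold * s, sub_mem (neg_mem hp) (mul_mem gold_mem hs),
    -s, neg_mem hs, s + s + r, add_mem (add_mem hs hs) hr,
    h.mul_genA_inv.of_eq ?_ ?_ ?_ ?_⟩ <;>
    simp only [Prod.fst_add, Prod.fst_neg, Prod.fst_mul, Prod.fst_sub, gold] <;> grind

theorem IsEvenWord.mul_genB (h : IsEvenWord w) : IsOddWord (w * genB) := by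
  obtain ⟨p, hp, q, hq, r, hr, s, hs, h⟩ := h
  refine ⟨-r, neg_mem hr, -s, neg_mem hs, p, hp, q, hq, h.mul_genB.of_eq ?_ ?_ rfl rfl⟩ <;>
    simp only [Prod.fst_neg, mul_neg]

theorem IsOddWord.mul_genB (h : IsOddWord w) : IsEvenWord (w * genB) := by
  obtain ⟨p, hp, q, hq, r, hr, s, hs, h⟩ := h
  refine ⟨-r, neg_mem hr, -s, neg_mem hs, p, hp, q, hq, h.mul_genB.of_eq ?_ ?_ rfl rfl⟩ <;>
    simp only [Prod.fst_neg, mul_neg]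

theorem IsEvenWord.mul_genB_inv (h : IsEvenWord w) : IsOddWord (w * genB⁻¹) := by
  obtain ⟨p, hp, q, hq, r, hr, s, hs, h⟩ := h
  refine ⟨r, hr, s, hs, -p, neg_mem hp, -q, neg_mem hq,
    h.mul_genB_inv.of_eq rfl rfl ?_ ?_⟩ <;> simp only [Prod.fst_neg, mul_neg]

theorem IsOddWord.mul_genB_inv (h : IsOddWord w) : IsEvenWord (w * genB⁻¹) := by
  obtain ⟨p, hp, q, hq, r, hr, s, hs, h⟩ := h
  refine ⟨r, hr, s, hs, -p, neg_mem hp, -q, neg_mem hq,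
    h.mul_genB_inv.of_eq rfl rfl ?_ ?_⟩ <;> simp only [Prod.fst_neg, mul_neg]

theorem isEvenWord_one : IsEvenWord 1 :=
  ⟨1, one_mem _, 0, zero_mem _, 0, zero_mem _, 0, zero_mem _, by constructor <;> simp⟩

theorem isEvenWord_or_isOddWord (hw : w ∈ Subgroup.closure {genA, genB}) :
    IsEvenWord w ∨ IsOddWord w := by
  induction hw using Subgroup.closure_induction_right with
  | one => exact Or.inl isEvenWord_one
  | mul_right x _ y hy hx =>
    rcases hy with rfl | rfl
    · exact hx.elim (Or.inr ·.mul_genA) (Or.inl ·.mul_genA)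
    · exact hx.elim (Or.inr ·.mul_genB) (Or.inl ·.mul_genB)
  | mul_inv_cancel x _ y hy hx =>
    rcases hy with rfl | rfl
    · exact hx.elim (Or.inr ·.mul_genA_inv) (Or.inl ·.mul_genA_inv)
    · exact hx.elim (Or.inr ·.mul_genB_inv) (Or.inl ·.mul_genB_inv)

end Words

theorem goldenConj_bounds : -0.62 < goldenConj ∧ goldenConj < 0 := by
  have := Real.goldenRatio_add_goldenConj
  constructor <;> linarith [goldenRatio_lt, Real.one_lt_goldenRatio]

/-- The form `a² + b² + x² + y² + ψ (a b - a y - x b - x y)` is bounded below by half of the sum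
of squares. The conjugates of the determinant on even and on odd words are both of this shape. -/
theorem sum_sq_le_two {a b x y : ℝ}
    (h : a ^ 2 + b ^ 2 + x ^ 2 + y ^ 2 + goldenConj * (a * b - a * y - x * b - x * y) = 1) :
    a ^ 2 + b ^ 2 + x ^ 2 + y ^ 2 ≤ 2 := by
  obtain ⟨h1, h2⟩ := goldenConj_bounds
  have ht : goldenConj ^ 2 ≤ 1 / 2 := by nlinarith
  nlinarith [sq_nonneg (a + goldenConj * (b - y)), sq_nonneg (x - goldenConj * (b + y)),
    mul_nonneg (sub_nonneg.2 ht) (add_nonneg (sq_nonneg b) (sq_nonneg y))]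

theorem abs_le_three_halves {x : ℝ} (h : x ^ 2 ≤ 2) : |x| ≤ 3 / 2 :=
  abs_le_of_sq_le_sq (by linarith) (by norm_num)

/-- The coordinates of a matrix close to the identity are close to those of the identity. The
constants come from `gap ≥ 1 / 2`, `√2 / 2 ≤ 1` and `rootU ≤ 2`. -/
theorem HasCoords.abs_le {w : SL(2, ℝ)} {P Q R S ε : ℝ} (h : HasCoords w P Q R S)
    (h00 : |w 0 0 - 1| ≤ ε) (h01 : |w 0 1| ≤ ε) (h10 : |w 1 0| ≤ ε) (h11 : |w 1 1 - 1| ≤ ε) :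
    |P - 1| ≤ 13 * ε ∧ |Q| ≤ 4 * ε ∧ |R| ≤ 13 * ε ∧ |S| ≤ 4 * ε := by
  obtain ⟨hg, hg'⟩ := gap_bounds
  have hc : |√2 / 2| ≤ 1 := by
    have : √2 ≤ 2 := by rw [Real.sqrt_le_left (by norm_num)]; norm_num
    rw [abs_of_nonneg (by positivity)]; linarith
  have hu : |rootU| ≤ 2 := by
    rw [rootU, abs_of_nonneg (by linarith [Real.goldenRatio_pos])]
    linarith [goldenRatio_lt]
  have key : ∀ X Y Z : ℝ, |X| ≤ ε → |Y| ≤ ε → X + Y = Z * gap → |Z| ≤ 4 * ε := by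
    intro X Y Z hX hY hZ
    have h1 := congrArg abs hZ
    rw [abs_mul, abs_of_pos (by linarith : 0 < gap)] at h1
    have h2 := abs_add_le X Y
    nlinarith [abs_nonneg Z]
  have hQ : |Q| ≤ 4 * ε := key _ _ Q h01 h10 (by
    rw [h.h01, h.h10, ← rootU_sub_rootV]; ring)
  have hS : |S| ≤ 4 * ε := key (w 0 0 - 1) (-(w 1 1 - 1)) S h00 (by rwa [abs_neg]) (by
    rw [h.h00, h.h11, ← rootU_sub_rootV]; ring)
  have hε : 0 ≤ ε := (abs_nonneg _).trans h01
  have hmul : ∀ X Y C K : ℝ, |X| ≤ K → |Y| ≤ C → |X * Y| ≤ K * C := fun X Y C K hX hY => by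
    rw [abs_mul]
    exact mul_le_mul hX hY (abs_nonneg _) ((abs_nonneg _).trans hX)
  refine ⟨?_, hQ, ?_, hS⟩
  · have : P - 1 = (w 0 0 - 1) - Q * (√2 / 2) - S * rootU := by rw [h.h00]; ring
    rw [this]
    linarith [abs_sub (w 0 0 - 1 - Q * (√2 / 2)) (S * rootU), abs_sub (w 0 0 - 1) (Q * (√2 / 2)),
      hmul _ _ _ _ hQ hc, hmul _ _ _ _ hS hu]
  · have : R = Q * rootU - S * (√2 / 2) - w 0 1 := by rw [h.h01]; ring
    rw [this]
    linarith [abs_sub (Q * rootU - S * (√2 / 2)) (w 0 1), abs_sub (Q * rootU) (S * (√2 / 2)),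
      hmul _ _ _ _ hQ hu, hmul _ _ _ _ hS hc]

theorem eq_zero_of_small {x : ℝ × ℝ} (hx : x ∈ goldenIntegers) (h1 : |x.1| ≤ 0.13)
    (h2 : |x.2| ≤ 3) : x = 0 := by
  refine eq_zero_of_abs_mul_lt_one hx ?_
  nlinarith [abs_nonneg x.1, abs_nonneg x.2]

theorem abs_le_of_sqrt_two_mul {x K : ℝ} (h : |√2 * x| ≤ K) : |x| ≤ K := by
  have : 1 ≤ √2 := by rw [Real.one_le_sqrt]; norm_num
  rw [abs_mul, abs_of_nonneg (by positivity)] at h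
  nlinarith [abs_nonneg x]

theorem eq_one_of_isEvenWord {w : SL(2, ℝ)} (hw : IsEvenWord w) (h00 : |w 0 0 - 1| ≤ 0.01)
    (h01 : |w 0 1| ≤ 0.01) (h10 : |w 1 0| ≤ 0.01) (h11 : |w 1 1 - 1| ≤ 0.01) : w = 1 := by
  obtain ⟨p, hp, q, hq, r, hr, s, hs, h⟩ := hw
  have h2 := sqrt_two_sq
  -- The determinant equation is conjugated to the other real place of `ℤ[φ]`.
  have hn : p * p + (q * q + q * q) + (r * r + r * r) + s * s + ((p * q + r * s) + (p * q + r * s))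
      + gold * (p * s - (q * r + q * r)) - 1 = 0 := by
    refine eq_zero_of_fst_eq_zero ?_ ?_
    · have := gold_mem
      have := one_mem goldenIntegers
      repeat first | assumption | apply sub_mem | apply add_mem | apply mul_mem
    · have := h.norm_eq_one
      simp only [Prod.fst_add, Prod.fst_sub, Prod.fst_mul, Prod.fst_one, gold]
      grind
  have hn2 := congrArg Prod.snd hn
  simp only [Prod.snd_add, Prod.snd_sub, Prod.snd_mul, Prod.snd_one, Prod.snd_zero, gold] at hn2
  have hle := sum_sq_le_two (a := p.2 + q.2) (b := r.2 + s.2) (x := q.2) (y := r.2)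
    (by linear_combination hn2)
  have hb : |q.2| ≤ 3 / 2 := abs_le_three_halves (by nlinarith)
  have hb2 : |r.2| ≤ 3 / 2 := abs_le_three_halves (by nlinarith)
  have hb3 : |p.2 + q.2| ≤ 3 / 2 := abs_le_three_halves (by nlinarith)
  have hb4 : |r.2 + s.2| ≤ 3 / 2 := abs_le_three_halves (by nlinarith)
  have hp2 : |p.2| ≤ 2 := by
    refine abs_le_of_sq_le_sq ?_ (by norm_num)
    nlinarith [sq_nonneg (p.2 + q.2 + q.2), sq_nonneg (r.2 + s.2), sq_nonneg r.2]
  obtain ⟨hP, hQ, hR, hS⟩ := h.abs_le h00 h01 h10 h11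
  have hs2 : |s.2| ≤ 3 := by
    have : s.2 = (r.2 + s.2) - r.2 := by ring
    rw [this]; linarith [abs_sub (r.2 + s.2) r.2]
  have hq0 := eq_zero_of_small hq (by linarith [abs_le_of_sqrt_two_mul hQ]) (by linarith)
  have hr0 := eq_zero_of_small hr (by linarith [abs_le_of_sqrt_two_mul hR]) (by linarith)
  have hs0 := eq_zero_of_small hs (by linarith) hs2
  have hp1 := eq_zero_of_small (x := p - 1) (sub_mem hp (one_mem _))
    (by simp only [Prod.fst_sub, Prod.fst_one]; linarith) (by
      simp only [Prod.snd_sub, Prod.snd_one]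
      have := abs_sub p.2 1
      rw [abs_one] at this; linarith)
  have hp1' : p = 1 := sub_eq_zero.1 hp1
  subst hq0 hr0 hs0 hp1'
  apply ext_entries
  · rw [h.h00]; simp
  · rw [h.h01]; simp
  · rw [h.h10]; simp
  · rw [h.h11]; simp

theorem not_isOddWord {w : SL(2, ℝ)} (h00 : |w 0 0 - 1| ≤ 0.01)
    (h01 : |w 0 1| ≤ 0.01) (h10 : |w 1 0| ≤ 0.01) (h11 : |w 1 1 - 1| ≤ 0.01) :
    ¬ IsOddWord w := by
  rintro ⟨p, hp, q, hq, r, hr, s, hs, h⟩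
  have h2 := sqrt_two_sq
  have hn : (p * p + p * p) + q * q + r * r + (s * s + s * s) + ((p * q + r * s) + (p * q + r * s))
      + gold * ((p * s + p * s) - q * r) - 1 = 0 := by
    refine eq_zero_of_fst_eq_zero ?_ ?_
    · have := gold_mem
      have := one_mem goldenIntegers
      repeat first | assumption | apply sub_mem | apply add_mem | apply mul_mem
    · have := h.norm_eq_one
      simp only [Prod.fst_add, Prod.fst_sub, Prod.fst_mul, Prod.fst_one, gold]
      grind
  have hn2 := congrArg Prod.snd hn
  simp only [Prod.snd_add, Prod.snd_sub, Prod.snd_mul, Prod.snd_one, Prod.snd_zero, gold] at hn2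
  have hle := sum_sq_le_two (a := -(p.2 + q.2)) (b := r.2 + s.2) (x := -p.2) (y := s.2)
    (by linear_combination hn2)
  have hb : |p.2| ≤ 3 / 2 := abs_le_three_halves (by nlinarith)
  have hb2 : |s.2| ≤ 3 / 2 := abs_le_three_halves (by nlinarith)
  have hb3 : |p.2 + q.2| ≤ 3 / 2 := abs_le_three_halves (by nlinarith)
  have hb4 : |r.2 + s.2| ≤ 3 / 2 := abs_le_three_halves (by nlinarith)
  obtain ⟨-, hQ, hR, hS⟩ := h.abs_le h00 h01 h10 h11
  have hq2 : |q.2| ≤ 3 := by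
    have : q.2 = (p.2 + q.2) - p.2 := by ring
    rw [this]; linarith [abs_sub (p.2 + q.2) p.2]
  have hr2 : |r.2| ≤ 3 := by
    have : r.2 = (r.2 + s.2) - s.2 := by ring
    rw [this]; linarith [abs_sub (r.2 + s.2) s.2]
  have hq0 := eq_zero_of_small hq (by linarith) hq2
  have hr0 := eq_zero_of_small hr (by linarith) hr2
  have hs0 := eq_zero_of_small hs (by linarith [abs_le_of_sqrt_two_mul hS]) (by linarith)
  subst hq0 hr0 hs0
  -- What remains is `2 p² = 1`, which is impossible since `p` has integral norm.
  obtain ⟨k, hk⟩ := exists_int_eq_norm hp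
  have e1 := congrArg Prod.fst hn
  simp only [Prod.fst_add, Prod.fst_sub, Prod.fst_mul, Prod.fst_one, Prod.fst_zero] at e1
  simp only [Prod.snd_zero] at hn2
  have : (4 * k ^ 2 : ℝ) = 1 := by
    rw [← hk]
    have e1' : 2 * p.1 ^ 2 = 1 := by linear_combination e1
    have e2' : 2 * p.2 ^ 2 = 1 := by linear_combination hn2
    linear_combination (2 * p.2 ^ 2) * e1' + e2'
  have h4 : 4 * k ^ 2 = 1 := by exact_mod_cast this
  omega

/-- In the group generated by `A` and `B` only the identity is close to the identity. -/
theorem eq_one_of_mem_closure {w : SL(2, ℝ)} (hw : w ∈ Subgroup.closure {genA, genB})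
    (h00 : |w 0 0 - 1| ≤ 0.01) (h01 : |w 0 1| ≤ 0.01) (h10 : |w 1 0| ≤ 0.01)
    (h11 : |w 1 1 - 1| ≤ 0.01) : w = 1 :=
  (isEvenWord_or_isOddWord hw).elim (fun h => eq_one_of_isEvenWord h h00 h01 h10 h11)
    fun h => absurd h (not_isOddWord h00 h01 h10 h11)

/-! ### The triangle group is Kleinian -/

open Real (goldenRatio)

/-- The inclusion of `SL(2, ℝ)` in `SL(2, ℂ)`. -/
def toC : SL(2, ℝ) →* SL(2, ℂ) := Matrix.SpecialLinearGroup.map (algebraMap ℝ ℂ)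

theorem toC_entry (w : SL(2, ℝ)) (i j : Fin 2) : toC w i j = ((w i j : ℝ) : ℂ) := rfl

theorem toPSL_eq_mk (w : SL(2, ℝ)) : toPSL w = ((toC w : SL(2, ℂ)) : PSL(2, ℂ)) := rfl

theorem toC_injective : Function.Injective toC := fun x y h => by
  apply ext_entries <;> apply Complex.ofReal_injective <;> simp only [← toC_entry, h]

theorem toC_neg (w : SL(2, ℝ)) : toC (-w) = -toC w := by
  ext i j
  simp [toC_entry]

theorem toPSL_eq_toPSL {x y : SL(2, ℝ)} (h : toPSL x = toPSL y) : y = x ∨ y = -x := by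
  rcases eq_or_eq_neg (A := toC x) (B := toC y) h with h | h
  · exact Or.inl (toC_injective h)
  · rw [← toC_neg] at h
    exact Or.inr (toC_injective h)

theorem toPSL_neg (w : SL(2, ℝ)) : toPSL (-w) = toPSL w := by
  rw [toPSL_eq_mk, toPSL_eq_mk, toC_neg, QuotientGroup.eq]
  have : (-toC w)⁻¹ * toC w = -1 := by
    rw [inv_mul_eq_iff_eq_mul]; simp
  rw [this]; exact neg_one_mem_center

/-- The group generated by the two rotations. -/
def triangleGroup : Subgroup SL(2, ℝ) := Subgroup.closure {genA, genB}

theorem genA_mem : genA ∈ triangleGroup := Subgroup.subset_closure (by simp)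

theorem genB_mem : genB ∈ triangleGroup := Subgroup.subset_closure (by simp)

theorem genB_mul_self : genB * genB = -1 := by
  apply ext_entries <;> simp [mul_entry, genB, mk2_00, mk2_01, mk2_10, mk2_11]

theorem continuous_entry (i j : Fin 2) : Continuous fun x : SL(2, ℂ) => x i j :=
  (continuous_apply j).comp ((continuous_apply i).comp continuous_subtype_val)

/-- The uniform gap around the identity makes the group discrete in `SL(2, ℂ)`. -/
theorem discreteTopology_map_toC : DiscreteTopology (triangleGroup.map toC) := by
  rw [discreteTopology_iff_eventually]
  have key : ∀ i j, ∀ᶠ x : SL(2, ℂ) in 𝓝 1, ‖x i j - (1 : SL(2, ℂ)) i j‖ ≤ 0.01 := fun i j => by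
    have : Tendsto (fun x : SL(2, ℂ) => ‖x i j - (1 : SL(2, ℂ)) i j‖) (𝓝 1)
        (𝓝 ‖(1 : SL(2, ℂ)) i j - (1 : SL(2, ℂ)) i j‖) :=
      (((continuous_entry i j).sub continuous_const).norm).tendsto 1
    rw [sub_self, norm_zero] at this
    exact (this.eventually (gt_mem_nhds (by norm_num))).mono fun x hx => le_of_lt hx
  filter_upwards [key 0 0, key 0 1, key 1 0, key 1 1] with x h00 h01 h10 h11 hx
  obtain ⟨w, hw, rfl⟩ := hx
  have hn : ∀ r s : ℝ, ‖(r : ℂ) - (s : ℂ)‖ = |r - s| := fun r s => by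
    rw [← Complex.ofReal_sub, Complex.norm_real, Real.norm_eq_abs]
  rw [← map_one toC, toC_entry, toC_entry, hn] at h00 h01 h10 h11
  rw [eq_one_of_mem_closure hw (by simpa using h00) (by simpa using h01) (by simpa using h10)
    (by simpa using h11), map_one]

theorem center_le_map_toC : Subgroup.center SL(2, ℂ) ≤ triangleGroup.map toC := by
  intro x hx
  rcases eq_or_eq_neg (A := 1) (B := x) (QuotientGroup.eq.2 (by simpa using hx)) with rfl | rfl
  · exact Subgroup.one_mem _
  · exact ⟨-1, genB_mul_self ▸ triangleGroup.mul_mem genB_mem genB_mem, by rw [toC_neg, map_one]⟩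

theorem discreteTopology_map_toPSL : DiscreteTopology (triangleGroup.map toPSL) := by
  have h := discreteTopology_map_mk discreteTopology_map_toC center_le_map_toC
  rwa [Subgroup.map_map] at h

/-- By the Cayley–Hamilton theorem a power of a hyperbolic matrix `U` is `a U - b` with
`a ≠ 0`. -/
theorem exists_pow_eq {U : SL(2, ℝ)} (hU : 2 ≤ U 0 0 + U 1 1) (n : ℕ) :
    ∃ a b : ℝ, 0 ≤ b ∧ b < a ∧ (U ^ (n + 1)) 0 0 = a * U 0 0 - b ∧
      (U ^ (n + 1)) 0 1 = a * U 0 1 ∧ (U ^ (n + 1)) 1 0 = a * U 1 0 ∧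
      (U ^ (n + 1)) 1 1 = a * U 1 1 - b := by
  induction n with
  | zero => exact ⟨1, 0, le_rfl, one_pos, by simp⟩
  | succ n ih =>
    obtain ⟨a, b, hb, hba, h00, h01, h10, h11⟩ := ih
    have hd := det_eq_one U
    refine ⟨a * (U 0 0 + U 1 1) - b, a, by linarith, by nlinarith, ?_, ?_, ?_, ?_⟩ <;>
      rw [pow_succ, mul_entry]
    · rw [h00, h01]; linear_combination -a * hd
    · rw [h00, h01]; ring
    · rw [h10, h11]; ring
    · rw [h10, h11]; linear_combination -a * hd

theorem pow_mul_pow_ne {U V : SL(2, ℝ)} (hU : 2 ≤ U 0 0 + U 1 1) (hV : 2 ≤ V 0 0 + V 1 1)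
    (hUV : U 0 1 * V 1 0 ≠ V 0 1 * U 1 0) {m n : ℕ} (hm : 0 < m) (hn : 0 < n) :
    U ^ m * V ^ n ≠ V ^ n * U ^ m := by
  intro h
  obtain ⟨m, rfl⟩ := Nat.exists_eq_add_one.2 hm
  obtain ⟨n, rfl⟩ := Nat.exists_eq_add_one.2 hn
  obtain ⟨a, b, hb, hba, h00, h01, h10, -⟩ := exists_pow_eq hU m
  obtain ⟨a', b', hb', hba', h00', h01', h10', -⟩ := exists_pow_eq hV n
  have h' := congrArg (fun X : SL(2, ℝ) => X 0 0) h
  simp only [mul_entry, h00, h01, h10, h00', h01', h10'] at h'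
  have : a * a' * (U 0 1 * V 1 0 - V 0 1 * U 1 0) = 0 := by linear_combination h'
  rcases mul_eq_zero.1 this with h0 | h0
  · exact absurd h0 (mul_pos (by linarith) (by linarith)).ne'
  · exact hUV (sub_eq_zero.1 h0)

/-- A group that contains two hyperbolic matrices whose powers never commute is not virtually
abelian. -/
theorem not_isVirtuallyAbelian_map_toPSL {Γ : Subgroup SL(2, ℝ)} {U V : SL(2, ℝ)} (hUΓ : U ∈ Γ)
    (hVΓ : V ∈ Γ) (hU : 2 ≤ U 0 0 + U 1 1) (hV : 2 ≤ V 0 0 + V 1 1)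
    (hUV : U 0 1 * V 1 0 ≠ V 0 1 * U 1 0) : ¬ IsVirtuallyAbelian (Γ.map toPSL) := by
  rintro ⟨K, hK, hcomm⟩
  have hpow := fun (X : SL(2, ℝ)) (hX : X ∈ Γ) =>
    K.exists_pow_mem_of_index_ne_zero hK.index_ne_zero ⟨toPSL X, Subgroup.mem_map_of_mem _ hX⟩
  obtain ⟨m, hm, -, hm'⟩ := hpow U hUΓ
  obtain ⟨n, hn, -, hn'⟩ := hpow V hVΓ
  have h : toPSL (U ^ m * V ^ n) = toPSL (V ^ n * U ^ m) := by
    have := congrArg Subtype.val (hcomm _ hm' _ hn')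
    simpa using this
  -- The lifts to `SL(2, ℝ)` may anticommute, but then their squares commute.
  refine pow_mul_pow_ne hU hV hUV (m := m * 2) (n := n) (by omega) hn ?_
  rw [pow_mul, pow_two]
  rcases toPSL_eq_toPSL h with h | h
  · rw [mul_assoc, ← h, ← mul_assoc, ← h, mul_assoc]
  · rw [mul_assoc, ← neg_eq_iff_eq_neg.2 h, mul_neg, ← mul_assoc, ← neg_eq_iff_eq_neg.2 h,
      neg_mul, neg_neg, mul_assoc]

theorem rootU_mul_self_add : rootU ^ 2 + rootV ^ 2 = goldenRatio := by
  have h1 : (rootU + rootV) ^ 2 = goldenRatio ^ 2 := by rw [rootU_add_rootV]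
  linear_combination h1 - 2 * rootU_mul_rootV + Real.goldenRatio_sq

theorem commutator_entries :
    (genA * genB * genA⁻¹ * genB⁻¹) 0 0 = rootU ^ 2 + 1 / 2 ∧
    (genA * genB * genA⁻¹ * genB⁻¹) 0 1 = √2 / 2 * gap ∧
    (genA * genB * genA⁻¹ * genB⁻¹) 1 0 = √2 / 2 * gap ∧
    (genA * genB * genA⁻¹ * genB⁻¹) 1 1 = rootV ^ 2 + 1 / 2 := by
  have h2 := sqrt_two_sq
  rw [← rootU_sub_rootV]
  simp only [mul_entry, inv_00, inv_01, inv_10, inv_11, genA, genB, mk2_00, mk2_01, mk2_10, mk2_11]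
  refine ⟨?_, ?_, ?_, ?_⟩ <;> grind

theorem isKleinian_map_toPSL : IsKleinian (triangleGroup.map toPSL) := by
  refine ⟨discreteTopology_map_toPSL, ?_⟩
  obtain ⟨h00, h01, h10, h11⟩ := commutator_entries
  have hmem : genA * genB * genA⁻¹ * genB⁻¹ ∈ triangleGroup :=
    triangleGroup.mul_mem (triangleGroup.mul_mem (triangleGroup.mul_mem genA_mem genB_mem)
      (triangleGroup.inv_mem genA_mem)) (triangleGroup.inv_mem genB_mem)
  generalize genA * genB * genA⁻¹ * genB⁻¹ = U at *
  have hU : 2 ≤ U 0 0 + U 1 1 := by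
    rw [h00, h11]; linarith [rootU_mul_self_add, lt_goldenRatio]
  have h2 := sqrt_two_sq
  have huv := rootU_mul_rootV
  refine not_isVirtuallyAbelian_map_toPSL hmem (V := genA * U * genA⁻¹)
    (triangleGroup.mul_mem (triangleGroup.mul_mem genA_mem hmem) (triangleGroup.inv_mem genA_mem))
    hU ?_ ?_
  · have : (genA * U * genA⁻¹) 0 0 + (genA * U * genA⁻¹) 1 1 = U 0 0 + U 1 1 := by
      simp only [mul_entry, inv_00, inv_01, inv_10, inv_11]
      linear_combination (U 0 0 + U 1 1) * det_eq_one genA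
    rw [this]; exact hU
  · have : U 0 1 * (genA * U * genA⁻¹) 1 0 - (genA * U * genA⁻¹) 0 1 * U 1 0 =
        gap ^ 3 * goldenRatio := by
      rw [← rootU_sub_rootV] at *
      rw [← rootU_add_rootV]
      simp only [mul_entry, inv_00, inv_01, inv_10, inv_11, genA, mk2_00, mk2_01, mk2_10, mk2_11,
        h00, h01, h10, h11]
      grind
    rw [← sub_ne_zero, this]
    have := gap_bounds.1
    have := Real.goldenRatio_pos
    positivity

/-! ### The parameters of the generators -/

theorem tr_toC_genA : tr (toC genA) = ((√2 : ℝ) : ℂ) := by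
  rw [tr_eq, toC_entry, toC_entry, genA, mk2_00, mk2_11]
  push_cast; ring

theorem tr_toC_genB : tr (toC genB) = 0 := by
  rw [tr_eq, toC_entry, toC_entry, genB, mk2_00, mk2_11]
  simp

theorem tr_toC_genA_mul_genB : tr (toC genA * toC genB) = ((goldenRatio : ℝ) : ℂ) := by
  rw [← map_mul, tr_eq, toC_entry, toC_entry, ← Complex.ofReal_add, ← rootU_add_rootV]
  simp [mul_entry, genA, genB, mk2_00, mk2_01, mk2_10, mk2_11]

theorem beta_genA : beta (toPSL genA) = -2 := by
  rw [toPSL_eq_mk, beta_coe]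
  have : tr (toC genA) ^ 2 = 2 := by rw [tr_toC_genA, ← Complex.ofReal_pow, sqrt_two_sq]; simp
  change tr (toC genA) ^ 2 - 4 = -2
  rw [this]; norm_num

theorem beta_genB : beta (toPSL genB) = -4 := by
  rw [toPSL_eq_mk, beta_coe]
  change tr (toC genB) ^ 2 - 4 = -4
  rw [tr_toC_genB]; norm_num

theorem gamma_genA_genB : gamma (toPSL genA) (toPSL genB) = (((√5 - 1) / 2 : ℝ) : ℂ) := by
  rw [toPSL_eq_mk, toPSL_eq_mk, gamma_coe]
  change gam (toC genA) (toC genB) = _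
  have h := tr_mul_sq (toC genA) (toC genB) tr_toC_genB
  rw [tr_toC_genA_mul_genB, tr_toC_genA] at h
  have h' : gam (toC genA) (toC genB) = ((goldenRatio ^ 2 + √2 ^ 2 - 4 : ℝ) : ℂ) := by
    rw [Complex.ofReal_sub, Complex.ofReal_add, Complex.ofReal_pow, Complex.ofReal_pow,
      Complex.ofReal_ofNat]
    linear_combination -h
  rw [h', Real.goldenRatio_sq, sqrt_two_sq, goldenRatio]
  congr 1; ring

/-! ### Rotations of the upper half-plane -/

open Real (goldenRatio)

section Rotation

variable {M M' : SL(2, ℝ)} {z : ℍ} {θ : ℝ}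

theorem denom_ne_zero (M : SL(2, ℝ)) (z : ℍ) :
    (M 1 0 : ℂ) * (z : ℂ) + (M 1 1 : ℂ) ≠ 0 := fun h => by
  have him := congrArg Complex.im h
  have hre := congrArg Complex.re h
  simp at him hre
  have hd := det_eq_one M
  rcases him with h0 | h0
  · rw [h0, zero_mul, zero_add] at hre
    rw [h0, hre] at hd
    simp at hd
  · exact z.im_ne_zero h0

theorem smul_eq_iff : M • z = z ↔
    (M 0 0 : ℂ) * (z : ℂ) + (M 0 1 : ℂ) = z * ((M 1 0 : ℂ) * (z : ℂ) + (M 1 1 : ℂ)) := by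
  rw [UpperHalfPlane.ext_iff, UpperHalfPlane.coe_specialLinearGroup_apply,
    div_eq_iff (by simpa using denom_ne_zero M z)]
  simp

theorem hasDerivAt_moebius (M : SL(2, ℝ)) (z : ℍ) :
    HasDerivAt (fun w : ℂ => ((M 0 0 : ℂ) * w + (M 0 1 : ℂ)) / ((M 1 0 : ℂ) * w + (M 1 1 : ℂ)))
      (1 / ((M 1 0 : ℂ) * (z : ℂ) + (M 1 1 : ℂ)) ^ 2) (z : ℂ) := by
  have h1 : HasDerivAt (fun w : ℂ => (M 0 0 : ℂ) * w + (M 0 1 : ℂ)) (M 0 0 : ℂ) (z : ℂ) := by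
    simpa using ((hasDerivAt_id (z : ℂ)).const_mul (M 0 0 : ℂ)).add_const (M 0 1 : ℂ)
  have h2 : HasDerivAt (fun w : ℂ => (M 1 0 : ℂ) * w + (M 1 1 : ℂ)) (M 1 0 : ℂ) (z : ℂ) := by
    simpa using ((hasDerivAt_id (z : ℂ)).const_mul (M 1 0 : ℂ)).add_const (M 1 1 : ℂ)
  have hd : ((M 0 0 : ℂ) * (M 1 1 : ℂ) - (M 0 1 : ℂ) * (M 1 0 : ℂ)) = 1 := by
    exact_mod_cast congrArg (fun x : ℝ => (x : ℂ)) (det_eq_one M)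
  refine (h1.div h2 (denom_ne_zero M z)).congr_deriv ?_
  congr 1
  linear_combination hd

theorem isRotation_iff : IsRotation M z θ ↔
    (M 0 0 : ℂ) * (z : ℂ) + (M 0 1 : ℂ) = z * ((M 1 0 : ℂ) * (z : ℂ) + (M 1 1 : ℂ)) ∧
      ((M 1 0 : ℂ) * (z : ℂ) + (M 1 1 : ℂ)) ^ 2 * Complex.exp ((θ : ℂ) * Complex.I) = 1 := by
  have h := hasDerivAt_moebius M z
  have h0 := pow_ne_zero 2 (denom_ne_zero M z)
  rw [IsRotation, smul_eq_iff]
  refine and_congr_right fun _ => ⟨fun h' => ?_, fun h' => ?_⟩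
  · rw [h'.unique h, mul_one_div_cancel h0]
  · exact h.congr_deriv (eq_div_of_mul_eq h0 (by rw [mul_comm, h'])).symm

/-- A rotation is determined by its centre and its angle, up to the sign of the matrix. -/
theorem IsRotation.eq_or_eq_neg (h : IsRotation M z θ) (h' : IsRotation M' z θ) :
    M' = M ∨ M' = -M := by
  rw [isRotation_iff] at h h'
  obtain ⟨h1, h2⟩ := h
  obtain ⟨h1', h2'⟩ := h'
  have hsq := mul_right_cancel₀ (Complex.exp_ne_zero _) (h2'.trans h2.symm)
  have hz := z.im_ne_zero
  have key : ∀ a b c d : ℝ, (a : ℂ) * z + b = c * z + d → a = c ∧ b = d := fun a b c d h => by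
    have him := congrArg Complex.im h
    have hre := congrArg Complex.re h
    simp at him hre
    have hac : a = c := him.resolve_right hz
    exact ⟨hac, by rw [hac] at hre; linarith⟩
  rcases sq_eq_sq_iff_eq_or_eq_neg.1 hsq with h | h
  · obtain ⟨e1, e2⟩ := key _ _ _ _ h
    obtain ⟨e3, e4⟩ := key _ _ _ _ (h1'.trans ((congrArg (_ * ·) h).trans h1.symm))
    exact Or.inl (ext_entries e3 e4 e1 e2)
  · obtain ⟨e1, e2⟩ := key _ _ (-M 1 0) (-M 1 1) (by rw [h]; push_cast; ring)
    obtain ⟨e3, e4⟩ := key _ _ (-M 0 0) (-M 0 1) (by rw [h1', h]; push_cast; linear_combination h1)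
    refine Or.inr (ext_entries ?_ ?_ ?_ ?_) <;> simpa

end Rotation

/-! ### Angles of hyperbolic triangles -/

theorem discChart_eq_smul (z w : ℍ) : discChart z w =
    (Complex.normSq ((w : ℂ) - (starRingEnd ℂ) (z : ℂ)))⁻¹ •
      ((Complex.normSq w : ℂ) - 2 * (w.re : ℂ) * z + (z : ℂ) ^ 2) := by
  have h : (w : ℂ) + (starRingEnd ℂ) (w : ℂ) = 2 * (w.re : ℂ) := by
    rw [Complex.add_conj]; simp
  rw [discChart, div_eq_mul_inv, Complex.inv_def, Complex.real_smul, map_sub, Complex.conj_conj,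
    ← Complex.mul_conj]
  linear_combination -(((Complex.normSq ((w : ℂ) - (starRingEnd ℂ) (z : ℂ)))⁻¹ : ℝ) : ℂ) * z * h

/-- The disc chart at `z` takes `w` to a positive multiple of `(w - z) (w̄ - z)`, and positive factors
do not affect angles. -/
theorem hyperbolicAngle_eq (z w₁ w₂ : ℍ) : hyperbolicAngle z w₁ w₂ = InnerProductGeometry.angle
    ((Complex.normSq w₁ : ℂ) - 2 * (w₁.re : ℂ) * z + (z : ℂ) ^ 2)
    ((Complex.normSq w₂ : ℂ) - 2 * (w₂.re : ℂ) * z + (z : ℂ) ^ 2) := by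
  have hpos : ∀ w : ℍ, 0 < (Complex.normSq ((w : ℂ) - (starRingEnd ℂ) (z : ℂ)))⁻¹ := fun w => by
    refine inv_pos.2 (Complex.normSq_pos.2 fun h => ?_)
    have := congrArg Complex.im h
    simp at this
    linarith [w.im_pos, z.im_pos]
  rw [hyperbolicAngle, discChart_eq_smul, discChart_eq_smul,
    InnerProductGeometry.angle_smul_left_of_pos _ _ (hpos w₁),
    InnerProductGeometry.angle_smul_right_of_pos _ _ (hpos w₂)]

theorem angle_eq_of_inner {x y : ℂ} {θ : ℝ} (h0 : 0 ≤ θ) (hπ : θ ≤ Real.pi) (hx : x ≠ 0)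
    (hy : y ≠ 0) (h : inner ℝ x y = ‖x‖ * ‖y‖ * Real.cos θ) :
    InnerProductGeometry.angle x y = θ := by
  have := norm_pos_iff.2 hx
  have := norm_pos_iff.2 hy
  rw [InnerProductGeometry.angle, h, mul_div_cancel_left₀ _ (by positivity),
    Real.arccos_cos h0 hπ]

/-! ### The triangle -/

/-- The height of the vertex with angle `π / 4`. -/
def height : ℝ := √2 * rootU

/-- The real part of the vertex with angle `π / 5`. -/
def vertexRe : ℝ := √2 / 2 * gap

/-- The imaginary part of the vertex with angle `π / 5`, which lies on the unit circle. -/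
def vertexIm : ℝ := √(1 - vertexRe ^ 2)

theorem rootU_pos : 0 < rootU := by
  rw [rootU]; linarith [gap_bounds.1, Real.goldenRatio_pos]

theorem height_pos : 0 < height := mul_pos (by positivity) rootU_pos

theorem vertexRe_pos : 0 < vertexRe := mul_pos (by positivity) (by linarith [gap_bounds.1])

theorem vertexRe_sq : vertexRe ^ 2 = gap ^ 2 / 2 := by
  rw [vertexRe]; linear_combination gap ^ 2 / 4 * sqrt_two_sq

theorem one_sub_vertexRe_sq_pos : 0 < 1 - vertexRe ^ 2 := by
  rw [vertexRe_sq, gap_sq]; linarith [goldenRatio_lt]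

theorem vertexIm_pos : 0 < vertexIm := Real.sqrt_pos.2 one_sub_vertexRe_sq_pos

theorem vertexRe_sq_add : vertexRe ^ 2 + vertexIm ^ 2 = 1 := by
  rw [vertexIm, Real.sq_sqrt one_sub_vertexRe_sq_pos.le]; ring

/-- The hyperbolic triangle closes up: the relation between the height of one vertex and the real
part of the other. -/
theorem height_sq : height ^ 2 = 1 + 2 * vertexRe * height := by
  have h2 := sqrt_two_sq
  have h3 := rootU_mul_rootV
  rw [height, vertexRe, ← rootU_sub_rootV]
  grind

/-- The vertex with angle `π / 4`. -/
def vertexB : ℍ := ⟨⟨0, height⟩, height_pos⟩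

/-- The vertex with angle `π / 5`. -/
def vertexC : ℍ := ⟨⟨vertexRe, vertexIm⟩, vertexIm_pos⟩

theorem coe_vertexB : (vertexB : ℂ) = (height : ℂ) * Complex.I := by
  apply Complex.ext <;> simp [vertexB]

theorem coe_vertexC : (vertexC : ℂ) = (vertexRe : ℂ) + (vertexIm : ℂ) * Complex.I := by
  apply Complex.ext <;> simp [vertexC]

theorem re_vertexB : vertexB.re = 0 := rfl

theorem re_vertexC : vertexC.re = vertexRe := rfl

theorem normSq_vertexB : Complex.normSq (vertexB : ℂ) = height ^ 2 := by
  rw [Complex.normSq_apply, coe_vertexB]; simp; ring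

theorem normSq_vertexC : Complex.normSq (vertexC : ℂ) = 1 := by
  rw [Complex.normSq_apply, coe_vertexC, ← vertexRe_sq_add]; simp; ring

theorem vertexC_sq : (vertexC : ℂ) ^ 2 = 2 * vertexRe * vertexC - 1 := by
  have h : (vertexRe : ℂ) ^ 2 + (vertexIm : ℂ) ^ 2 = 1 := by exact_mod_cast vertexRe_sq_add
  rw [coe_vertexC]
  linear_combination -h + (vertexIm : ℂ) ^ 2 * Complex.I_sq

theorem angle_at_I : hyperbolicAngle UpperHalfPlane.I vertexB vertexC = Real.pi / 2 := by
  rw [hyperbolicAngle_eq, ← InnerProductGeometry.inner_eq_zero_iff_angle_eq_pi_div_two,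
    re_vertexB, re_vertexC, normSq_vertexB, normSq_vertexC, Complex.inner]
  simp [-Complex.ofReal_pow]

theorem angle_at_vertexB : hyperbolicAngle vertexB vertexC UpperHalfPlane.I = Real.pi / 4 := by
  have hk : (height : ℂ) ^ 2 = 1 + 2 * vertexRe * height := by exact_mod_cast height_sq
  have e1 : ((Complex.normSq vertexC : ℂ) - 2 * (vertexC.re : ℂ) * vertexB + (vertexB : ℂ) ^ 2) =
      (-(2 * vertexRe * height)) • ((1 : ℂ) + Complex.I) := by
    rw [normSq_vertexC, re_vertexC, coe_vertexB, Complex.real_smul]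
    push_cast
    linear_combination (height : ℂ) ^ 2 * Complex.I_sq - hk
  have e2 : ((Complex.normSq UpperHalfPlane.I : ℂ) - 2 * (UpperHalfPlane.I.re : ℂ) * vertexB +
      (vertexB : ℂ) ^ 2) = (-(2 * vertexRe * height)) • (1 : ℂ) := by
    rw [coe_vertexB, Complex.real_smul]
    simp
    linear_combination (height : ℂ) ^ 2 * Complex.I_sq - hk
  have hne : -(2 * vertexRe * height) ≠ 0 := by
    have := vertexRe_pos
    have := height_pos
    exact neg_ne_zero.2 (by positivity)
  have hI : (1 : ℂ) + Complex.I ≠ 0 := fun h => by simpa using congrArg Complex.re h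
  rw [hyperbolicAngle_eq, e1, e2, InnerProductGeometry.angle_smul_smul hne]
  refine angle_eq_of_inner (by positivity) (by linarith [Real.pi_pos]) hI one_ne_zero ?_
  have hn : ‖(1 : ℂ) + Complex.I‖ = √2 := by
    rw [Complex.norm_def, Complex.normSq_apply]; norm_num
  rw [hn, Real.cos_pi_div_four, Complex.inner]
  simp
  linear_combination -sqrt_two_sq / 2

theorem angle_at_vertexC : hyperbolicAngle vertexC UpperHalfPlane.I vertexB = Real.pi / 5 := by
  have hk : (height : ℂ) ^ 2 = 1 + 2 * vertexRe * height := by exact_mod_cast height_sq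
  have e1 : ((Complex.normSq UpperHalfPlane.I : ℂ) - 2 * (UpperHalfPlane.I.re : ℂ) * vertexC +
      (vertexC : ℂ) ^ 2) = (2 * vertexRe) • (vertexC : ℂ) := by
    rw [Complex.real_smul, vertexC_sq]
    simp
  have e2 : ((Complex.normSq vertexB : ℂ) - 2 * (vertexB.re : ℂ) * vertexC + (vertexC : ℂ) ^ 2) =
      (2 * vertexRe) • ((vertexC : ℂ) + height) := by
    rw [normSq_vertexB, re_vertexB, vertexC_sq, Complex.real_smul]
    push_cast
    linear_combination hk
  have hne : 2 * vertexRe ≠ 0 := by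
    have := vertexRe_pos
    positivity
  have hpos : (vertexC : ℂ) + height ≠ 0 := fun h => by
    have := congrArg Complex.im h
    simp [coe_vertexC] at this
    exact vertexIm_pos.ne' this
  rw [hyperbolicAngle_eq, e1, e2, InnerProductGeometry.angle_smul_smul hne]
  refine angle_eq_of_inner (by positivity) (by linarith [Real.pi_pos]) vertexC.ne_zero hpos ?_
  have hn1 : ‖(vertexC : ℂ)‖ = 1 := by rw [Complex.norm_def, normSq_vertexC, Real.sqrt_one]
  have hn2 : ‖(vertexC : ℂ) + height‖ = √2 * height := by
    rw [Complex.norm_def, Real.sqrt_eq_iff_mul_self_eq (Complex.normSq_nonneg _)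
      (mul_nonneg (by positivity) height_pos.le), Complex.normSq_apply, coe_vertexC]
    simp
    linear_combination vertexRe_sq_add - height_sq - height ^ 2 * sqrt_two_sq
  have hin : inner ℝ (vertexC : ℂ) ((vertexC : ℂ) + height) = 1 + vertexRe * height := by
    rw [Complex.inner, coe_vertexC, ← vertexRe_sq_add]
    simp
    ring
  rw [hn1, hn2, hin, Real.cos_pi_div_five]
  have h2 := sqrt_two_sq
  have h3 := rootU_mul_rootV
  have h4 : (1 + √5) / 4 = (rootU + rootV) / 2 := by rw [rootU_add_rootV, goldenRatio]; ring
  rw [h4, height, vertexRe, ← rootU_sub_rootV]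
  grind

/-! ### The rotations about the vertices -/

theorem isRotation_genB : IsRotation genB UpperHalfPlane.I (2 * Real.pi / (2 : ℕ)) := by
  rw [isRotation_iff]
  have : ((2 * Real.pi / (2 : ℕ) : ℝ) : ℂ) * Complex.I = Real.pi * Complex.I := by
    push_cast; ring
  rw [this, Complex.exp_pi_mul_I]
  simp [genB, mk2_00, mk2_01, mk2_10, mk2_11]

theorem rootV_mul_height : rootV * height = √2 / 2 := by
  rw [height]; linear_combination √2 * rootU_mul_rootV

theorem isRotation_genA : IsRotation genA vertexB (2 * Real.pi / (4 : ℕ)) := by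
  rw [isRotation_iff]
  have h1 : ((2 * Real.pi / (4 : ℕ) : ℝ) : ℂ) * Complex.I = Real.pi / 2 * Complex.I := by
    push_cast; ring
  have h2 : (rootV : ℂ) * height = (√2 : ℝ) / 2 := by exact_mod_cast rootV_mul_height
  have h3 : (height : ℂ) = (√2 : ℝ) * rootU := by exact_mod_cast rfl
  have h4 : ((√2 : ℝ) : ℂ) ^ 2 = 2 := by exact_mod_cast sqrt_two_sq
  rw [h1, Complex.exp_pi_div_two_mul_I, coe_vertexB]
  simp only [genA, mk2_00, mk2_01, mk2_10, mk2_11]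
  push_cast
  constructor
  · linear_combination (height : ℂ) * Complex.I ^ 2 * h2 +
      ((√2 : ℝ) : ℂ) / 2 * height * Complex.I_sq - ((√2 : ℝ) : ℂ) / 2 * h3 - (rootU : ℂ) / 2 * h4
  · have h5 : -(rootV : ℂ) * (height * Complex.I) + (√2 : ℝ) / 2 =
        (√2 : ℝ) / 2 * (1 - Complex.I) := by linear_combination -Complex.I * h2
    rw [h5]
    linear_combination (1 - Complex.I) ^ 2 * Complex.I / 4 * h4 +
      (Complex.I / 2 - 1) * Complex.I_sq

theorem cos_pi_div_five_eq : Real.cos (Real.pi / 5) = goldenRatio / 2 := by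
  rw [Real.cos_pi_div_five, goldenRatio]; ring

theorem sin_pi_div_five_eq : Real.sin (Real.pi / 5) = √2 / 2 * vertexIm := by
  have h1 : 0 ≤ Real.sin (Real.pi / 5) :=
    Real.sin_nonneg_of_nonneg_of_le_pi (by positivity) (by linarith [Real.pi_pos])
  have h2 : 0 ≤ √2 / 2 * vertexIm := mul_nonneg (by positivity) vertexIm_pos.le
  rw [← sq_eq_sq₀ h1 h2, Real.sin_sq, cos_pi_div_five_eq]
  linear_combination -Real.goldenRatio_sq / 4 - vertexIm ^ 2 / 4 * sqrt_two_sq -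
    vertexRe_sq_add / 2 + vertexRe_sq / 2 + gap_sq / 4

/-- The product of the other two rotations, inverted, is the rotation about the third vertex. -/
theorem isRotation_mul_inv :
    IsRotation (genA * genB)⁻¹ vertexC (2 * Real.pi / (5 : ℕ)) := by
  have e00 : (genA * genB)⁻¹ 0 0 = rootV := by
    rw [inv_00, mul_entry]; simp [genA, genB, mk2_01, mk2_10, mk2_11]
  have e01 : (genA * genB)⁻¹ 0 1 = √2 / 2 := by
    rw [inv_01, mul_entry]; simp [genA, genB, mk2_00, mk2_01, mk2_11]
  have e10 : (genA * genB)⁻¹ 1 0 = -(√2 / 2) := by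
    rw [inv_10, mul_entry]; simp [genA, genB, mk2_00, mk2_10, mk2_11]
  have e11 : (genA * genB)⁻¹ 1 1 = rootU := by
    rw [inv_11, mul_entry]; simp [genA, genB, mk2_00, mk2_01, mk2_10]
  have h2 : √2 / 2 * vertexRe = gap / 2 := by
    rw [vertexRe]; linear_combination gap / 4 * sqrt_two_sq
  have hgap := rootU_sub_rootV
  have hφ := rootU_add_rootV
  rw [isRotation_iff, e00, e01, e10, e11]
  constructor
  · have h2' : ((√2 / 2 : ℝ) : ℂ) * vertexRe = (gap / 2 : ℝ) := by exact_mod_cast h2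
    have hgap' : (rootU : ℂ) - rootV = gap := by exact_mod_cast hgap
    push_cast at h2' ⊢
    linear_combination ((√2 : ℝ) : ℂ) / 2 * vertexC_sq + 2 * vertexC * h2' - vertexC * hgap'
  · have hexp : ((-(√2 / 2) : ℝ) : ℂ) * vertexC + (rootU : ℝ) =
        Complex.exp (((-(Real.pi / 5) : ℝ) : ℂ) * Complex.I) := by
      apply Complex.ext
      · rw [Complex.exp_ofReal_mul_I_re, Real.cos_neg, cos_pi_div_five_eq, Complex.add_re,
          Complex.re_ofReal_mul, Complex.ofReal_re]
        change -(√2 / 2) * vertexRe + rootU = _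
        linear_combination -h2 + hgap / 2 + hφ / 2
      · rw [Complex.exp_ofReal_mul_I_im, Real.sin_neg, sin_pi_div_five_eq, Complex.add_im,
          Complex.im_ofReal_mul, Complex.ofReal_im]
        change -(√2 / 2) * vertexIm + 0 = _
        ring
    rw [hexp, ← Complex.exp_nat_mul, ← Complex.exp_add, Complex.exp_eq_one_iff]
    refine ⟨0, ?_⟩
    push_cast; ring

theorem isHyperbolicTriangleGroup_map_toPSL :
    IsHyperbolicTriangleGroup 2 4 5 (triangleGroup.map toPSL) := by
  refine ⟨le_rfl, by norm_num, by norm_num, UpperHalfPlane.I, vertexB, vertexC, ?_, ?_, ?_,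
    by exact_mod_cast angle_at_I, by exact_mod_cast angle_at_vertexB,
    by exact_mod_cast angle_at_vertexC, 1, ?_⟩
  · intro h
    have h1 : height = 1 := by
      have := congrArg UpperHalfPlane.im h
      exact (this.symm : height = UpperHalfPlane.I.im).trans (by simp)
    have h2 := height_sq
    rw [h1] at h2
    linarith [vertexRe_pos]
  · intro h
    exact vertexRe_pos.ne (congrArg UpperHalfPlane.re h)
  · intro h
    have : vertexRe = UpperHalfPlane.I.re := congrArg UpperHalfPlane.re h
    exact vertexRe_pos.ne' (this.trans (by simp))
  · have hid : (MulAut.conj (1 : PSL(2, ℂ))).toMonoidHom = MonoidHom.id _ := by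
      ext; simp
    rw [hid, Subgroup.map_id]
    refine le_antisymm (Subgroup.map_mono ?_) ?_
    · rw [triangleGroup, Subgroup.closure_le]
      rintro M (rfl | rfl)
      · exact Subgroup.subset_closure (Or.inr (Or.inl isRotation_genA))
      · exact Subgroup.subset_closure (Or.inl isRotation_genB)
    · rw [Subgroup.map_le_iff_le_comap, Subgroup.closure_le]
      have key : ∀ {M R : SL(2, ℝ)} {z : ℍ} {θ : ℝ}, R ∈ triangleGroup → IsRotation R z θ →
          IsRotation M z θ → toPSL M ∈ triangleGroup.map toPSL := fun {M R z θ} hR hRz hMz => by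
        rcases hRz.eq_or_eq_neg hMz with rfl | rfl
        · exact Subgroup.mem_map_of_mem _ hR
        · rw [toPSL_neg]; exact Subgroup.mem_map_of_mem _ hR
      rintro M (hM | hM | hM)
      · exact key genB_mem isRotation_genB hM
      · exact key genA_mem isRotation_genA hM
      · exact key (triangleGroup.inv_mem (triangleGroup.mul_mem genA_mem genB_mem))
          isRotation_mul_inv hM

/-- The triangle group in `PSL(2, ℂ)` is generated by the images of its two generators. -/
theorem map_toPSL_triangleGroup :
    triangleGroup.map toPSL = Subgroup.closure {toPSL genA, toPSL genB} := by
  rw [triangleGroup, MonoidHom.map_closure, Set.image_pair]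

end PrincipalCharacter

end

theorem mainTheorem2 :
    (∀ (f g : PSL(2, ℂ)) (γ β : ℂ),
      PrincipalCharacter.IsKleinian (Subgroup.closure {f, g}) →
      PrincipalCharacter.principalCharacter f g = (γ, β, -4) →
      (Real.sqrt 5 - 1) / 2 ≤ ‖γ‖ + ‖β + 2‖) ∧
    (∃ (f g : PSL(2, ℂ)) (γ β : ℂ),
      PrincipalCharacter.IsKleinian (Subgroup.closure {f, g}) ∧
      PrincipalCharacter.IsHyperbolicTriangleGroup 2 4 5 (Subgroup.closure {f, g}) ∧
      PrincipalCharacter.principalCharacter f g = (γ, β, -4) ∧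
      γ = (((Real.sqrt 5 - 1) / 2 : ℝ) : ℂ) ∧ β = -2 ∧
      ‖γ‖ + ‖β + 2‖ = (Real.sqrt 5 - 1) / 2) := by
  refine ⟨fun f g γ β hK hpc => PrincipalCharacter.inequality_of_isKleinian hK hpc,
    PrincipalCharacter.toPSL PrincipalCharacter.genA,
    PrincipalCharacter.toPSL PrincipalCharacter.genB, _, -2, ?_, ?_, ?_, rfl, rfl, ?_⟩
  · rw [← PrincipalCharacter.map_toPSL_triangleGroup]
    exact PrincipalCharacter.isKleinian_map_toPSL
  · rw [← PrincipalCharacter.map_toPSL_triangleGroup]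
    exact PrincipalCharacter.isHyperbolicTriangleGroup_map_toPSL
  · rw [PrincipalCharacter.principalCharacter, PrincipalCharacter.gamma_genA_genB,
      PrincipalCharacter.beta_genA, PrincipalCharacter.beta_genB]
  · have h : (1 : ℝ) ≤ √5 := by rw [Real.one_le_sqrt]; norm_num
    rw [Complex.norm_real, Real.norm_of_nonneg (by linarith)]
    simp
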